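/- Let $M$ be a transitive model of ZFC (a set or a proper class). All notions prefixed by "$M\models$" are understood with quantifiers restricted to $M$. Suppose that $M\models\langle X,\tau\rangle$ is an interpretable space, i.e. a regular Hausdorff space which is the image under a continuous open surjection of a Čech complete space (a $G_\delta$ subspace of a compact Hausdorff space), and that $M\models\mathcal B$ is the Borel $\sigma$-algebra of $\langle X,\tau\rangle$ (the least $\sigma$-algebra on $X$ containing $\tau$). A *topological preinterpretation* of $\langle X,\tau\rangle$ over $M$ consists of a $\mathrm T_0$ topological space $\langle\hat X,\hat\tau\rangle$ and maps $\pi\colon X\to\hat X$ and $\pi\colon\tau\to\hat\tau$ such that: (1) for $x\in X$ and $O\in\tau$, $x\in O$ if and only if $\pi(x)\in\pi(O)$; (2) $\pi(O\cap P)=\pi(O)\cap\pi(P)$ for $O,P\in\tau$, and $\pi(\bigcup D)=\bigcup_{O\in D}\pi(O)$ for every $D\subseteq\tau$ with $D\in M$; (3) $\pi(\emptyset)=\emptyset$ and $\pi(X)=\hat X$; (4) $\{\pi(O):O\in\tau\}$ is a basis of $\hat\tau$. A preinterpretation $\pi_0$ with space $\hat X_0$ is *reducible* to a preinterpretation $\pi_1$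 with space $\hat X_1$ if there is a map $h\colon\hat X_0\to\hat X_1$ with $\pi_1=h\circ\pi_0$ on $X$ and $h^{-1}(\pi_1(O))=\pi_0(O)$ for all $O\in\tau$. An *interpretation* is a preinterpretation to which every preinterpretation is reducible. Theorem. Let $\pi\colon\langle X,\tau\rangle\to\langle\hat X,\hat\tau\rangle$ be an interpretation and let $\hat{\mathcal B}$ be the Borel $\sigma$-algebra of $\hat X$. Then there is exactly one map $\pi^*\colon\mathcal B\to\hat{\mathcal B}$ such that 1. $\pi^*(O)=\pi(O)$ for every $O\in\tau$; 2. $\pi^*(X\setminus B)=\hat X\setminus\pi^*(B)$ for every $B\in\mathcal B$; 3. $\pi^*\left(\bigcup_n B_n\right)=\bigcup_n\pi^*(B_n)$ and $\pi^*\left(\bigcap_n B_n\right)=\bigcap_n\pi^*(B_n)$ for every sequence $\langle B_n:n\in\omega\rangle\in M$ of elements of $\mathcal B$. -/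

import Mathlib

/-!  Models of set theory are structures `V` with a binary relation `∈` on `V`.  The notions below
are the set-theoretic ones with every quantifier ranging over `V`, so that for a class `M` of sets
the instance `V = M` of a notion `φ` reads "`M ⊨ φ`". -/

universe u

namespace SetModel

section Internal

variable {V : Type*} [Membership V V]

/-! ### Elementary set theory in a model -/

/-- The elements of `a` in the model. -/
abbrev El (a : V) : Type _ := {x : V // x ∈ a}

/-- `a ⊆ b`. -/
def Sub (a b : V) : Prop := ∀ x : V, x ∈ a → x ∈ b

/-- `e = ∅`. -/
def IsEmptySet (e : V) : Prop := ∀ x : V, x ∉ e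

/-- `a ∩ b = ∅`. -/
def Disj (a b : V) : Prop := ∀ x : V, x ∈ a → x ∉ b

/-- `p = {a, b}`. -/
def IsUPair (p a b : V) : Prop := ∀ x : V, x ∈ p ↔ x = a ∨ x = b

/-- `p = ⟨a, b⟩ = {{a}, {a, b}}`. -/
def IsOPair (p a b : V) : Prop := ∃ s t : V, IsUPair s a a ∧ IsUPair t a b ∧ IsUPair p s t

/-- `u = ⋃ d`. -/
def IsUnion (u d : V) : Prop := ∀ x : V, x ∈ u ↔ ∃ y : V, y ∈ d ∧ x ∈ y

/-- `c = a ∩ b`. -/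
def IsInter (c a b : V) : Prop := ∀ x : V, x ∈ c ↔ x ∈ a ∧ x ∈ b

/-- `c = a \ b`. -/
def IsDiff (c a b : V) : Prop := ∀ x : V, x ∈ c ↔ x ∈ a ∧ x ∉ b

/-- `t = s ∪ {s}`. -/
def IsSucc (t s : V) : Prop := ∀ x : V, x ∈ t ↔ x ∈ s ∨ x = s

/-- `w` contains `∅` and is closed under `s ↦ s ∪ {s}`. -/
def IsInductive (w : V) : Prop :=
  (∃ e : V, IsEmptySet e ∧ e ∈ w) ∧ ∀ s : V, s ∈ w → ∃ t : V, IsSucc t s ∧ t ∈ w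

/-- `w = ω`, the least inductive set. -/
def IsOmega (w : V) : Prop := IsInductive w ∧ ∀ v : V, IsInductive v → Sub w v

/-- `⟨x, y⟩ ∈ f`. -/
def App (f x y : V) : Prop := ∃ p : V, IsOPair p x y ∧ p ∈ f

/-- `f` is a function from `a` to `b`. -/
def IsFun (f a b : V) : Prop :=
  (∀ p : V, p ∈ f → ∃ x y : V, x ∈ a ∧ y ∈ b ∧ IsOPair p x y) ∧
    ∀ x : V, x ∈ a → ∃! y : V, App f x y

/-- The function `f` takes every element of `b` as a value. -/
def IsOnto (f b : V) : Prop := ∀ y : V, y ∈ b → ∃ x : V, App f x y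

/-- `c = {x ∈ a : f(x) ∈ b}`. -/
def IsPreimage (c f a b : V) : Prop := ∀ x : V, x ∈ c ↔ x ∈ a ∧ ∃ y : V, y ∈ b ∧ App f x y

/-- `c = {f(x) : x ∈ a}`. -/
def IsImage (c f a : V) : Prop := ∀ y : V, y ∈ c ↔ ∃ x : V, x ∈ a ∧ App f x y

/-- `a` is finite: the image of a natural number under some function. -/
def IsFin (a : V) : Prop :=
  ∃ w n f : V, IsOmega w ∧ n ∈ w ∧ IsFun f n a ∧ IsOnto f a

/-- `f` is a sequence `⟨f(n) : n ∈ ω⟩` of elements of `a`. -/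
def IsSeq (f a : V) : Prop := ∃ w : V, IsOmega w ∧ IsFun f w a

/-- `u = ⋃ {f(n) : n ∈ ω}` for a sequence `f`. -/
def IsSeqUnion (u f : V) : Prop := ∀ x : V, x ∈ u ↔ ∃ n y : V, App f n y ∧ x ∈ y

/-- `u = ⋂ {f(n) : n ∈ ω}` for a sequence `f`. -/
def IsSeqInter (u f : V) : Prop := ∀ x : V, x ∈ u ↔ ∀ n y : V, App f n y → x ∈ y

/-! ### Topology in a model -/

/-- `τ` is a topology on the set `X`. -/
def IsTop (X τ : V) : Prop :=
  (∀ O : V, O ∈ τ → Sub O X) ∧ X ∈ τ ∧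
    (∀ O P : V, O ∈ τ → P ∈ τ → ∃ Q : V, IsInter Q O P ∧ Q ∈ τ) ∧
    ∀ D : V, Sub D τ → ∃ U : V, IsUnion U D ∧ U ∈ τ

/-- `C` is a closed subset of `⟨X, τ⟩`. -/
def IsClosedSet (X τ C : V) : Prop := Sub C X ∧ ∃ O : V, O ∈ τ ∧ IsDiff O X C

/-- `⟨X, τ⟩` is Hausdorff. -/
def IsHausdorff (X τ : V) : Prop :=
  ∀ x y : V, x ∈ X → y ∈ X → x ≠ y →
    ∃ O P : V, O ∈ τ ∧ P ∈ τ ∧ x ∈ O ∧ y ∈ P ∧ Disj O P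

/-- In `⟨X, τ⟩`, points can be separated from closed sets. -/
def IsRegular (X τ : V) : Prop :=
  ∀ x C : V, x ∈ X → IsClosedSet X τ C → x ∉ C →
    ∃ O P : V, O ∈ τ ∧ P ∈ τ ∧ x ∈ O ∧ Sub C P ∧ Disj O P

/-- Every open cover of `⟨X, τ⟩` has a finite subcover. -/
def IsCompactTop (X τ : V) : Prop :=
  ∀ D : V, Sub D τ → IsUnion X D → ∃ F : V, IsFin F ∧ Sub F D ∧ IsUnion X F

/-- `Y` is a `G_δ` subset of `⟨K, κ⟩`. -/
def IsGdeltaSet (K κ Y : V) : Prop :=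
  Sub Y K ∧ ∃ f : V, IsSeq f κ ∧ IsSeqInter Y f

/-- `σ = {O ∩ Y : O ∈ κ}`. -/
def IsSubspaceTop (κ Y σ : V) : Prop := ∀ S : V, S ∈ σ ↔ ∃ O : V, O ∈ κ ∧ IsInter S O Y

/-- `⟨Y, σ⟩` is Čech complete: a `G_δ` subspace of a compact Hausdorff space `⟨K, κ⟩`. -/
def IsCechComplete (Y σ : V) : Prop :=
  ∃ K κ : V, IsTop K κ ∧ IsHausdorff K κ ∧ IsCompactTop K κ ∧
    IsGdeltaSet K κ Y ∧ IsSubspaceTop κ Y σ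

/-- `f` is a continuous open map of `⟨Y, σ⟩` onto `⟨X, τ⟩`. -/
def IsContOpenOnto (f Y σ X τ : V) : Prop :=
  IsFun f Y X ∧ IsOnto f X ∧
    (∀ O : V, O ∈ τ → ∃ P : V, IsPreimage P f Y O ∧ P ∈ σ) ∧
    ∀ P : V, P ∈ σ → ∃ O : V, IsImage O f P ∧ O ∈ τ

/-- `⟨X, τ⟩` is interpretable: a regular Hausdorff, continuous open image of a Čech complete
space. -/
def IsInterpretable (X τ : V) : Prop :=
  IsTop X τ ∧ IsHausdorff X τ ∧ IsRegular X τ ∧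
    ∃ Y σ f : V, IsCechComplete Y σ ∧ IsContOpenOnto f Y σ X τ

/-- `A` is a `σ`-algebra of subsets of `X`. -/
def IsSigmaAlg (X A : V) : Prop :=
  (∀ B : V, B ∈ A → Sub B X) ∧ X ∈ A ∧
    (∀ B : V, B ∈ A → ∃ C : V, IsDiff C X B ∧ C ∈ A) ∧
    ∀ f : V, IsSeq f A → ∃ U : V, IsSeqUnion U f ∧ U ∈ A

/-- `𝓑` is the Borel `σ`-algebra of `⟨X, τ⟩`: the least `σ`-algebra on `X` containing `τ`. -/
def IsBorelAlg (X τ 𝓑 : V) : Prop :=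
  IsSigmaAlg X 𝓑 ∧ Sub τ 𝓑 ∧ ∀ A : V, IsSigmaAlg X A → Sub τ A → Sub 𝓑 A

end Internal

/-! ### Models of ZFC -/

/-- The only symbol of the language of set theory: a binary relation symbol. -/
inductive MemRel : ℕ → Type
  | mem : MemRel 2

/-- The first-order language of set theory. -/
def setLang : FirstOrder.Language.{0, 0} := ⟨fun _ => Empty, MemRel⟩

instance memStructure (V : Type*) [Membership V V] : setLang.Structure V where
  funMap := fun f => Empty.elim f
  RelMap := fun {_} r => match r with
    | MemRel.mem => fun v => v 0 ∈ v 1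

/-- `V` satisfies every axiom of ZFC. `Definable Set.univ` means first-order definable in `⟨V, ∈⟩`
with arbitrary parameters, so `separation` and `replacement` are the usual schemas. -/
structure ZFC (V : Type*) [Membership V V] : Prop where
  extensionality : ∀ a b : V, (∀ x : V, x ∈ a ↔ x ∈ b) → a = b
  foundation : ∀ a x : V, x ∈ a → ∃ y : V, y ∈ a ∧ Disj y a
  pairing : ∀ a b : V, ∃ p : V, IsUPair p a b
  union : ∀ d : V, ∃ u : V, IsUnion u d
  powerset : ∀ a : V, ∃ p : V, ∀ x : V, x ∈ p ↔ Sub x a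
  infinity : ∃ w : V, IsInductive w
  separation : ∀ D : Set V, (Set.univ : Set V).Definable₁ setLang D →
    ∀ a : V, ∃ b : V, ∀ x : V, x ∈ b ↔ x ∈ a ∧ x ∈ D
  replacement : ∀ R : Set (V × V), (Set.univ : Set V).Definable₂ setLang R →
    ∀ a : V, (∀ x : V, x ∈ a → ∃! y : V, (x, y) ∈ R) →
      ∃ b : V, ∀ y : V, y ∈ b ↔ ∃ x : V, x ∈ a ∧ (x, y) ∈ R
  choice : ∀ a : V, (∀ x : V, x ∈ a → ∃ y : V, y ∈ x) →
    (∀ x y : V, x ∈ a → y ∈ a → x ≠ y → Disj x y) →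
      ∃ c : V, ∀ x : V, x ∈ a → ∃! y : V, y ∈ x ∧ y ∈ c

/-- A class `M` of sets is regarded as a structure with the true membership relation. -/
instance classMembership (M : Set ZFSet.{u}) : Membership M M where
  mem a x := (x : ZFSet.{u}) ∈ (a : ZFSet.{u})

/-- `M`, a set or a proper class, is a transitive model of set theory. -/
structure IsTransitiveModel (M : Set ZFSet.{u}) : Prop where
  transitive : ∀ a ∈ M, ∀ x ∈ a, x ∈ M
  zfc : ZFC M

/-! ### Interpretations -/

section Interpretation

variable {M : Set ZFSet.{u}}

/-- The maps `p` on points and `q` on open sets form a topological preinterpretation over `M` of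
`⟨X, τ⟩` in the space `Z`. Spaces are required to be `T₀`. -/
structure IsPreinterpretation (X τ : M) {Z : Type u} [TopologicalSpace Z]
    (p : El X → Z) (q : El τ → Set Z) : Prop where
  t0 : T0Space Z
  isOpen : ∀ O : El τ, IsOpen (q O)
  mem_iff : ∀ (x : El X) (O : El τ), x.1 ∈ O.1 ↔ p x ∈ q O
  inter : ∀ O P Q : El τ, IsInter Q.1 O.1 P.1 → q Q = q O ∩ q P
  union : ∀ (D : M) (hD : Sub D τ) (O : El τ), IsUnion O.1 D →
    q O = ⋃ P : El D, q ⟨P.1, hD P.1 P.2⟩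
  empty : ∀ O : El τ, IsEmptySet O.1 → q O = ∅
  whole : ∀ O : El τ, O.1 = X → q O = Set.univ
  basis : TopologicalSpace.IsTopologicalBasis (Set.range q)

/-- The preinterpretation `(p₀, q₀)` is reducible to `(p₁, q₁)`: there is a map `h` with
`p₁ = h ∘ p₀` and `h⁻¹(q₁(O)) = q₀(O)` for all `O ∈ τ`. -/
def Reducible {X τ : M} {Z₀ Z₁ : Type u} (p₀ : El X → Z₀) (q₀ : El τ → Set Z₀)
    (p₁ : El X → Z₁) (q₁ : El τ → Set Z₁) : Prop :=
  ∃ h : Z₀ → Z₁, p₁ = h ∘ p₀ ∧ ∀ O : El τ, h ⁻¹' q₁ O = q₀ O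

/-- `(p, q)` is an interpretation: a largest preinterpretation with respect to reducibility. -/
structure IsInterpretation (X τ : M) {Z : Type u} [TopologicalSpace Z]
    (p : El X → Z) (q : El τ → Set Z) : Prop where
  isPreinterpretation : IsPreinterpretation X τ p q
  largest : ∀ (Z₀ : Type u) [TopologicalSpace Z₀] (p₀ : El X → Z₀) (q₀ : El τ → Set Z₀),
    IsPreinterpretation X τ p₀ q₀ → Reducible p₀ q₀ p q

end Interpretation

end SetModel

open FirstOrder FirstOrder.Language

namespace SetModel

section Definability

variable {V : Type*} [Membership V V] {n : ℕ}

/-- A function on assignments that is given by a term: a variable or a parameter. -/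
class DefTerm (t : (Fin n → V) → V) : Prop where
  out : ∃ s : (setLang[[(Set.univ : Set V)]]).Term (Fin n), ∀ v, s.realize v = t v

/-- A predicate on assignments that is first-order definable with parameters. -/
class DefPred (P : (Fin n → V) → Prop) : Prop where
  out : (Set.univ : Set V).Definable setLang {v | P v}

instance DefTerm.var (i : Fin n) : DefTerm fun v : Fin n → V => v i :=
  ⟨⟨.var i, fun _ => rfl⟩⟩

instance DefTerm.const (c : V) : DefTerm fun _ : Fin n → V => c :=
  ⟨⟨(setLang.con (⟨c, trivial⟩ : (Set.univ : Set V))).term, fun _ => Term.realize_con⟩⟩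

namespace DefPred

theorem subst {m : ℕ} {P : (Fin m → V) → Prop} (hP : DefPred P) (t : Fin m → (Fin n → V) → V)
    (ht : ∀ i, DefTerm (t i)) : DefPred fun v => P fun i => t i v := by
  obtain ⟨φ, hφ⟩ := hP.out
  choose s hs using fun i => (ht i).out
  refine ⟨⟨BoundedFormula.subst φ s, ?_⟩⟩
  ext v
  have h : P (fun i => t i v) ↔ φ.Realize (fun i => t i v) := Set.ext_iff.1 hφ _
  have h2 := BoundedFormula.realize_subst (φ := φ) (tf := s) (v := v) (xs := default)
  simp only [hs] at h2
  exact h.trans h2.symm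

theorem subst₁ {P : V → Prop} (hP : DefPred fun v : Fin 1 → V => P (v 0))
    (a : (Fin n → V) → V) [ha : DefTerm a] : DefPred fun v => P (a v) :=
  hP.subst ![a] (fun i => by fin_cases i; exact ha)

theorem subst₂ {P : V → V → Prop} (hP : DefPred fun v : Fin 2 → V => P (v 0) (v 1))
    (a b : (Fin n → V) → V) [ha : DefTerm a] [hb : DefTerm b] : DefPred fun v => P (a v) (b v) :=
  hP.subst ![a, b] (fun i => by fin_cases i; exacts [ha, hb])

theorem subst₃ {P : V → V → V → Prop} (hP : DefPred fun v : Fin 3 → V => P (v 0) (v 1) (v 2))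
    (a b c : (Fin n → V) → V) [ha : DefTerm a] [hb : DefTerm b] [hc : DefTerm c] :
    DefPred fun v => P (a v) (b v) (c v) :=
  hP.subst ![a, b, c] (fun i => by fin_cases i; exacts [ha, hb, hc])

theorem subst₄ {P : V → V → V → V → Prop}
    (hP : DefPred fun v : Fin 4 → V => P (v 0) (v 1) (v 2) (v 3))
    (a b c d : (Fin n → V) → V) [ha : DefTerm a] [hb : DefTerm b] [hc : DefTerm c]
    [hd : DefTerm d] : DefPred fun v => P (a v) (b v) (c v) (d v) :=
  hP.subst ![a, b, c, d] (fun i => by fin_cases i; exacts [ha, hb, hc, hd])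

theorem congr {P Q : (Fin n → V) → Prop} (hP : DefPred P) (h : ∀ v, P v ↔ Q v) : DefPred Q := by
  have : P = Q := funext fun v => propext (h v)
  exact this ▸ hP

instance mem (a b : (Fin n → V) → V) [ha : DefTerm a] [hb : DefTerm b] :
    DefPred fun v => a v ∈ b v := by
  obtain ⟨s, hs⟩ := ha.out
  obtain ⟨t, ht⟩ := hb.out
  refine ⟨⟨((LHom.onRelation (L := setLang) (setLang.lhomWithConstants (Set.univ : Set V))
    MemRel.mem : (setLang[[(Set.univ : Set V)]]).Relations 2)).formula₂ s t, ?_⟩⟩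
  ext v
  refine Iff.trans ?_ Formula.realize_rel₂.symm
  rw [hs, ht]
  exact Iff.rfl

instance eq (a b : (Fin n → V) → V) [ha : DefTerm a] [hb : DefTerm b] :
    DefPred fun v => a v = b v := by
  obtain ⟨s, hs⟩ := ha.out
  obtain ⟨t, ht⟩ := hb.out
  refine ⟨⟨s.equal t, ?_⟩⟩
  ext v
  refine Iff.trans ?_ Formula.realize_equal.symm
  rw [hs, ht]
  exact Iff.rfl

variable {P Q : (Fin n → V) → Prop}

instance not [hP : DefPred P] : DefPred fun v => ¬ P v := ⟨hP.out.compl⟩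

instance ne (a b : (Fin n → V) → V) [DefTerm a] [DefTerm b] : DefPred fun v => a v ≠ b v :=
  inferInstanceAs (DefPred fun v => ¬ a v = b v)

instance notMem (a b : (Fin n → V) → V) [DefTerm a] [DefTerm b] : DefPred fun v => a v ∉ b v :=
  inferInstanceAs (DefPred fun v => ¬ a v ∈ b v)

instance and [hP : DefPred P] [hQ : DefPred Q] : DefPred fun v => P v ∧ Q v :=
  ⟨hP.out.inter hQ.out⟩

instance or [hP : DefPred P] [hQ : DefPred Q] : DefPred fun v => P v ∨ Q v :=
  ⟨hP.out.union hQ.out⟩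

instance imp [DefPred P] [DefPred Q] : DefPred fun v => P v → Q v :=
  congr (P := fun v => ¬ P v ∨ Q v) inferInstance fun _ => imp_iff_not_or.symm

instance iff [DefPred P] [DefPred Q] : DefPred fun v => P v ↔ Q v :=
  congr (P := fun v => (P v → Q v) ∧ (Q v → P v)) inferInstance fun _ => iff_def.symm

instance ex {P : (Fin n → V) → V → Prop}
    [hP : DefPred fun v : Fin (n + 1) → V => P (fun i => v i.succ) (v 0)] :
    DefPred fun v => ∃ x, P v x := by
  refine ⟨?_⟩
  have := hP.out.image_comp (Fin.succ : Fin n → Fin (n + 1))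
  convert this using 1
  ext v
  constructor
  · rintro ⟨x, hx⟩
    exact ⟨Fin.cons x v, by simpa using hx, by ext i; simp⟩
  · rintro ⟨w, hw, rfl⟩
    exact ⟨w 0, hw⟩

instance all {P : (Fin n → V) → V → Prop}
    [hP : DefPred fun v : Fin (n + 1) → V => P (fun i => v i.succ) (v 0)] :
    DefPred fun v => ∀ x, P v x := by
  have : DefPred fun v => ∃ x, ¬ P v x :=
    ex (P := fun v x => ¬ P v x) (hP := not (hP := hP))
  exact congr (not (hP := this)) fun v => by simp

instance exUnique {P : (Fin n → V) → V → Prop}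
    [hP : DefPred fun v : Fin (n + 1) → V => P (fun i => v i.succ) (v 0)] :
    DefPred fun v => ∃! x, P v x := by
  have h2 : DefPred fun v : Fin (n + 2) → V => P (fun i => v i.succ.succ) (v 0) :=
    hP.subst (Fin.cons (fun v => v 0) fun i v => v i.succ.succ)
      (Fin.cases (inferInstanceAs (DefTerm fun v => v 0))
        fun i => inferInstanceAs (DefTerm fun v => v i.succ.succ))
  exact inferInstanceAs (DefPred fun v => ∃ x, P v x ∧ ∀ y, P v y → y = x)

end DefPred

section Instances

variable (a b c d : (Fin n → V) → V) [DefTerm a] [DefTerm b] [DefTerm c] [DefTerm d]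

instance : DefPred fun v => Sub (a v) (b v) :=
  DefPred.subst₂ (P := Sub) (by unfold Sub; infer_instance) a b

instance : DefPred fun v => IsEmptySet (a v) :=
  DefPred.subst₁ (P := IsEmptySet) (by unfold IsEmptySet; infer_instance) a

instance : DefPred fun v => Disj (a v) (b v) :=
  DefPred.subst₂ (P := Disj) (by unfold Disj; infer_instance) a b

instance : DefPred fun v => IsUPair (a v) (b v) (c v) :=
  DefPred.subst₃ (P := IsUPair) (by unfold IsUPair; infer_instance) a b c

instance : DefPred fun v => IsOPair (a v) (b v) (c v) :=
  DefPred.subst₃ (P := IsOPair) (by unfold IsOPair; infer_instance) a b c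

instance : DefPred fun v => IsDiff (a v) (b v) (c v) :=
  DefPred.subst₃ (P := IsDiff) (by unfold IsDiff; infer_instance) a b c

instance : DefPred fun v => IsSucc (a v) (b v) :=
  DefPred.subst₂ (P := IsSucc) (by unfold IsSucc; infer_instance) a b

instance : DefPred fun v => IsInductive (a v) :=
  DefPred.subst₁ (P := IsInductive) (by unfold IsInductive; infer_instance) a

instance : DefPred fun v => IsOmega (a v) :=
  DefPred.subst₁ (P := IsOmega) (by unfold IsOmega; infer_instance) a

instance : DefPred fun v => App (a v) (b v) (c v) :=
  DefPred.subst₃ (P := App) (by unfold App; infer_instance) a b c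

instance : DefPred fun v => IsFun (a v) (b v) (c v) :=
  DefPred.subst₃ (P := IsFun) (by unfold IsFun; infer_instance) a b c

instance : DefPred fun v => IsOnto (a v) (b v) :=
  DefPred.subst₂ (P := IsOnto) (by unfold IsOnto; infer_instance) a b

instance : DefPred fun v => IsFin (a v) :=
  DefPred.subst₁ (P := IsFin) (by unfold IsFin; infer_instance) a

instance : DefPred fun v => IsSeq (a v) (b v) :=
  DefPred.subst₂ (P := IsSeq) (by unfold IsSeq; infer_instance) a b

end Instances

end Definability

end SetModel

namespace SetModel

/-- A model of ZFC whose membership relation is well-founded. -/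
class WFModel (V : Type*) [Membership V V] : Prop where
  zfc : ZFC V
  wf : WellFounded fun x y : V => x ∈ y

section SetTheory

variable {V : Type*} [Membership V V]

theorem IsFun.exists_app {f a b x : V} (h : IsFun f a b) (hx : x ∈ a) : ∃ y, App f x y :=
  (h.2 x hx).exists

theorem IsFun.mono {f a b c : V} (h : IsFun f a b) (hbc : Sub b c) : IsFun f a c :=
  ⟨fun p hp => let ⟨x, y, hx, hy, e⟩ := h.1 p hp; ⟨x, y, hx, hbc y hy, e⟩, h.2⟩

variable [hV : WFModel V]

theorem set_ext {a b : V} (h : ∀ x : V, x ∈ a ↔ x ∈ b) : a = b :=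
  hV.zfc.extensionality a b h

theorem mem_induction {P : V → Prop} (h : ∀ x, (∀ y : V, y ∈ x → P y) → P x) (x : V) : P x :=
  hV.wf.induction x h

theorem mem_irrefl (x : V) : x ∉ x := hV.wf.irrefl.irrefl x

/-! ### Operations -/

/-- `{a, b}`. -/
noncomputable def upair (a b : V) : V := (hV.zfc.pairing a b).choose

@[simp] theorem mem_upair {a b x : V} : x ∈ upair a b ↔ x = a ∨ x = b :=
  (hV.zfc.pairing a b).choose_spec x

theorem isUPair_iff {p a b : V} : IsUPair p a b ↔ p = upair a b :=
  ⟨fun h => set_ext fun x => (h x).trans mem_upair.symm, fun h _ => h ▸ mem_upair⟩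

/-- `⟨a, b⟩`. -/
noncomputable def opair (a b : V) : V := upair (upair a a) (upair a b)

theorem isOPair_iff {p a b : V} : IsOPair p a b ↔ p = opair a b := by
  simp only [IsOPair, isUPair_iff]
  exact ⟨fun ⟨s, t, hs, ht, h⟩ => by rw [h, hs, ht, opair], fun h => ⟨_, _, rfl, rfl, h⟩⟩

theorem upair_eq_upair {a b c d : V} :
    upair a b = upair c d ↔ a = c ∧ b = d ∨ a = d ∧ b = c := by
  constructor
  · intro h
    have h1 : ∀ x : V, (x = a ∨ x = b) ↔ (x = c ∨ x = d) := fun x => by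
      rw [← mem_upair, h, mem_upair]
    have ha := (h1 a).1 (.inl rfl)
    have hb := (h1 b).1 (.inr rfl)
    have hc := (h1 c).2 (.inl rfl)
    have hd := (h1 d).2 (.inr rfl)
    grind
  · rintro (⟨rfl, rfl⟩ | ⟨rfl, rfl⟩)
    · rfl
    · exact set_ext fun x => by simp [or_comm]

theorem opair_inj {a b c d : V} : opair a b = opair c d ↔ a = c ∧ b = d := by
  simp only [opair, upair_eq_upair]
  grind

theorem app_iff {f x y : V} : App f x y ↔ opair x y ∈ f := by
  simp [App, isOPair_iff]

theorem exists_sep (a : V) (P : V → Prop) [DefPred fun v : Fin 1 → V => P (v 0)] :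
    ∃ b : V, ∀ x : V, x ∈ b ↔ x ∈ a ∧ P x :=
  hV.zfc.separation {x | P x} (DefPred.out (P := fun v : Fin 1 → V => P (v 0))) a

/-- `{x ∈ a : P x}`. -/
noncomputable def sep (a : V) (P : V → Prop) [DefPred fun v : Fin 1 → V => P (v 0)] : V :=
  (exists_sep a P).choose

@[simp] theorem mem_sep {a x : V} {P : V → Prop} [DefPred fun v : Fin 1 → V => P (v 0)] :
    x ∈ sep a P ↔ x ∈ a ∧ P x :=
  (exists_sep a P).choose_spec x

theorem exists_image (a : V) (R : V → V → Prop) [h : DefPred fun v : Fin 2 → V => R (v 0) (v 1)]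
    (hR : ∀ x : V, x ∈ a → ∃! y : V, R x y) :
    ∃ b : V, ∀ y : V, y ∈ b ↔ ∃ x : V, x ∈ a ∧ R x y :=
  hV.zfc.replacement {p | R p.1 p.2} h.out a hR

/-- `⋃ d`. -/
noncomputable def sUn (d : V) : V := (hV.zfc.union d).choose

@[simp] theorem mem_sUn {d x : V} : x ∈ sUn d ↔ ∃ y : V, y ∈ d ∧ x ∈ y :=
  (hV.zfc.union d).choose_spec x

/-- The power set of `a`. -/
noncomputable def pow (a : V) : V := (hV.zfc.powerset a).choose

@[simp] theorem mem_pow {a x : V} : x ∈ pow a ↔ Sub x a :=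
  (hV.zfc.powerset a).choose_spec x

/-- `a ∪ {x}`. -/
noncomputable def adj (a x : V) : V := sUn (upair a (upair x x))

@[simp] theorem mem_adj {a x y : V} : y ∈ adj a x ↔ y ∈ a ∨ y = x := by
  simp [adj]

theorem isSucc_iff {t s : V} : IsSucc t s ↔ t = adj s s :=
  ⟨fun h => set_ext fun x => (h x).trans mem_adj.symm, fun h _ => h ▸ mem_adj⟩

variable (V) in
/-- `∅`. -/
noncomputable def emp : V := sep (hV.zfc.infinity.choose) fun x => x ≠ x

@[simp] theorem notMem_emp (x : V) : x ∉ emp V := by simp [emp]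

theorem isEmptySet_iff {e : V} : IsEmptySet e ↔ e = emp V :=
  ⟨fun h => set_ext fun x => by simp [h x], fun h x => by simp [h]⟩

/-- `a × b`. -/
noncomputable def prod (a b : V) : V :=
  sep (pow (pow (sUn (upair a b)))) fun p => ∃ x y : V, x ∈ a ∧ y ∈ b ∧ IsOPair p x y

theorem mem_prod {a b p : V} : p ∈ prod a b ↔ ∃ x y : V, x ∈ a ∧ y ∈ b ∧ p = opair x y := by
  simp only [prod, mem_sep, mem_pow, isOPair_iff, and_iff_right_iff_imp]
  rintro ⟨x, y, hx, hy, rfl⟩ s hs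
  rw [mem_pow]
  intro z hz
  simp only [opair, mem_upair] at hs
  rw [mem_sUn]
  rcases hs with rfl | rfl <;> simp only [mem_upair] at hz <;> grind [mem_upair]

@[simp] theorem opair_mem_prod {a b x y : V} : opair x y ∈ prod a b ↔ x ∈ a ∧ y ∈ b := by
  rw [mem_prod]
  constructor
  · rintro ⟨x', y', hx, hy, h⟩
    obtain ⟨rfl, rfl⟩ := opair_inj.1 h
    exact ⟨hx, hy⟩
  · exact fun ⟨hx, hy⟩ => ⟨x, y, hx, hy, rfl⟩

/-- A definable relation on `a × b`, as a set of pairs. -/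
theorem exists_relation (a b : V) (R : V → V → Prop)
    [h : DefPred fun v : Fin 2 → V => R (v 0) (v 1)] :
    ∃ f : V, (∀ p : V, p ∈ f → ∃ x y : V, x ∈ a ∧ y ∈ b ∧ p = opair x y) ∧
      ∀ x y : V, App f x y ↔ x ∈ a ∧ y ∈ b ∧ R x y := by
  have := fun {n : ℕ} (s t : (Fin n → V) → V) [DefTerm s] [DefTerm t] => h.subst₂ s t
  refine ⟨sep (prod a b) fun p => ∃ x y, IsOPair p x y ∧ R x y, fun p hp => ?_, fun x y => ?_⟩
  · exact mem_prod.1 (mem_sep.1 hp).1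
  · simp only [app_iff, mem_sep, opair_mem_prod, isOPair_iff, opair_inj]
    grind

theorem isFun_iff {f a b : V} : IsFun f a b ↔
    (∀ p : V, p ∈ f → ∃ x y : V, x ∈ a ∧ y ∈ b ∧ p = opair x y) ∧
      ∀ x : V, x ∈ a → ∃! y : V, App f x y := by
  simp only [IsFun, isOPair_iff]

theorem IsFun.mem_mem {f a b x y : V} (h : IsFun f a b) (hxy : App f x y) : x ∈ a ∧ y ∈ b := by
  obtain ⟨x', y', hx, hy, hp⟩ := (isFun_iff.1 h).1 _ (app_iff.1 hxy)
  obtain ⟨rfl, rfl⟩ := opair_inj.1 hp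
  exact ⟨hx, hy⟩

theorem IsFun.unique {f a b x y z : V} (h : IsFun f a b) (hy : App f x y) (hz : App f x z) :
    y = z :=
  (h.2 x (h.mem_mem hy).1).unique hy hz

theorem exists_function (a b : V) (R : V → V → Prop)
    [h : DefPred fun v : Fin 2 → V => R (v 0) (v 1)]
    (hR : ∀ x : V, x ∈ a → ∃! y : V, y ∈ b ∧ R x y) :
    ∃ f : V, IsFun f a b ∧ ∀ x y : V, App f x y ↔ x ∈ a ∧ y ∈ b ∧ R x y := by
  obtain ⟨f, hf, hf'⟩ := exists_relation a b R
  refine ⟨f, isFun_iff.2 ⟨hf, fun x hx => ?_⟩, hf'⟩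
  simpa [hf', hx] using hR x hx

/-- Choice of values: a definable total relation contains a function. -/
theorem exists_choice (a b : V) (R : V → V → Prop)
    [h : DefPred fun v : Fin 2 → V => R (v 0) (v 1)]
    (hR : ∀ x : V, x ∈ a → ∃ y : V, y ∈ b ∧ R x y) :
    ∃ f : V, IsFun f a b ∧ ∀ x y : V, App f x y → R x y := by
  have := fun {n : ℕ} (s t : (Fin n → V) → V) [DefTerm s] [DefTerm t] => h.subst₂ s t
  obtain ⟨r, hr', hr⟩ := exists_relation a b R
  have key : ∀ x ∈ a, ∃ e : V, ∀ q : V, q ∈ e ↔ ∃ y, App r x y ∧ IsOPair q x y := fun x hx => by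
    refine ⟨sep r fun q => ∃ y, IsOPair q x y, fun q => ?_⟩
    simp only [mem_sep, isOPair_iff, app_iff]
    grind
  let 𝓕 : V := sep (pow r) fun e => ∃ x, x ∈ a ∧ ∀ q, q ∈ e ↔ ∃ y, App r x y ∧ IsOPair q x y
  obtain ⟨c, hc⟩ := hV.zfc.choice 𝓕 (fun e he => by
      obtain ⟨-, x, hx, hq⟩ := mem_sep.1 he
      obtain ⟨y, hy, hxy⟩ := hR x hx
      exact ⟨opair x y, (hq _).2 ⟨y, (hr x y).2 ⟨hx, hy, hxy⟩, isOPair_iff.2 rfl⟩⟩)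
    (fun e e' he he' hne q hq hq' => by
      obtain ⟨-, x, hx, h1⟩ := mem_sep.1 he
      obtain ⟨-, x', hx', h2⟩ := mem_sep.1 he'
      obtain ⟨y, -, e1⟩ := (h1 _).1 hq
      obtain ⟨y', -, e2⟩ := (h2 _).1 hq'
      rw [isOPair_iff] at e1 e2
      obtain ⟨rfl, -⟩ := opair_inj.1 (e1.symm.trans e2)
      exact hne (set_ext fun q => (h1 q).trans (h2 q).symm))
  refine ⟨sep r (fun p => p ∈ c), isFun_iff.2 ⟨fun p hp => hr' p (mem_sep.1 hp).1, fun x hx => ?_⟩,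
    fun x y hxy => ((hr x y).1 (app_iff.2 (mem_sep.1 (app_iff.1 hxy)).1)).2.2⟩
  obtain ⟨e, he⟩ := key x hx
  have he𝓕 : e ∈ 𝓕 := by
    refine mem_sep.2 ⟨mem_pow.2 fun q hq => ?_, x, hx, he⟩
    obtain ⟨y, hy, e1⟩ := (he q).1 hq
    rw [isOPair_iff.1 e1, ← app_iff]
    exact hy
  obtain ⟨q, ⟨hq, hqc⟩, huniq⟩ := hc e he𝓕
  obtain ⟨y, hy, e1⟩ := (he q).1 hq
  rw [isOPair_iff] at e1
  subst e1
  refine ⟨y, app_iff.2 (mem_sep.2 ⟨app_iff.1 hy, hqc⟩), fun y' hy' => ?_⟩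
  have hy' := mem_sep.1 (app_iff.1 hy')
  have := huniq (opair x y') ⟨(he _).2 ⟨y', app_iff.2 hy'.1, isOPair_iff.2 rfl⟩, hy'.2⟩
  exact (opair_inj.1 this).2

/-! ### Natural numbers and finite sets -/

variable (V) in
/-- The natural number `k` of the model. -/
noncomputable def nat : ℕ → V
  | 0 => emp V
  | k + 1 => adj (nat k) (nat k)

theorem nat_mem_of_isInductive {w : V} (hw : IsInductive w) (k : ℕ) : nat V k ∈ w := by
  induction k with
  | zero =>
    obtain ⟨e, he, hew⟩ := hw.1
    rwa [isEmptySet_iff.1 he] at hew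
  | succ k ih =>
    obtain ⟨t, ht, htw⟩ := hw.2 _ ih
    rwa [isSucc_iff.1 ht] at htw

variable (V) in
theorem exists_omega : ∃ w : V, ∀ x, x ∈ w ↔ ∃ k, x = nat V k := by
  obtain ⟨w₀, hw₀⟩ := hV.zfc.infinity
  let w := sep w₀ fun x => ∀ v : V, IsInductive v → x ∈ v
  have hind : IsInductive w := by
    refine ⟨⟨emp V, isEmptySet_iff.2 rfl, mem_sep.2 ⟨nat_mem_of_isInductive hw₀ 0,
      fun v hv => nat_mem_of_isInductive hv 0⟩⟩, fun s hs => ⟨adj s s, isSucc_iff.2 rfl, ?_⟩⟩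
    have hs := mem_sep.1 hs
    have aux : ∀ v, IsInductive v → s ∈ v → adj s s ∈ v := fun v hv hsv => by
      obtain ⟨t, ht, htv⟩ := hv.2 s hsv
      rwa [isSucc_iff.1 ht] at htv
    exact mem_sep.2 ⟨aux _ hw₀ hs.1, fun v hv => aux v hv (hs.2 v hv)⟩
  refine ⟨w, fun x => ⟨?_, ?_⟩⟩
  · induction x using mem_induction with | h x ih => ?_
    intro hx
    let u := sep w fun x => IsEmptySet x ∨ ∃ y, y ∈ w ∧ IsSucc x y
    have hu : IsInductive u := by
      obtain ⟨e, he, hew⟩ := hind.1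
      refine ⟨⟨e, he, mem_sep.2 ⟨hew, .inl he⟩⟩, fun s hs => ?_⟩
      obtain ⟨t, ht, htw⟩ := hind.2 s (mem_sep.1 hs).1
      exact ⟨t, ht, mem_sep.2 ⟨htw, .inr ⟨s, (mem_sep.1 hs).1, ht⟩⟩⟩
    rcases (mem_sep.1 ((mem_sep.1 hx).2 u hu)).2 with h | ⟨y, hy, h⟩
    · exact ⟨0, isEmptySet_iff.1 h⟩
    · rw [isSucc_iff] at h
      subst h
      obtain ⟨k, rfl⟩ := ih y (mem_adj.2 (.inr rfl)) hy
      exact ⟨k + 1, rfl⟩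
  · rintro ⟨k, rfl⟩
    exact nat_mem_of_isInductive hind k

variable (V) in
/-- `ω`. -/
noncomputable def omega : V := (exists_omega V).choose

theorem mem_omega {x : V} : x ∈ omega V ↔ ∃ k, x = nat V k := (exists_omega V).choose_spec x

@[simp] theorem nat_mem_omega (k : ℕ) : nat V k ∈ omega V := mem_omega.2 ⟨k, rfl⟩

theorem isOmega_omega : IsOmega (omega V) := by
  refine ⟨⟨⟨emp V, isEmptySet_iff.2 rfl, nat_mem_omega 0⟩, fun s hs => ?_⟩, fun v hv x hx => ?_⟩
  · obtain ⟨k, rfl⟩ := mem_omega.1 hs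
    exact ⟨_, isSucc_iff.2 rfl, nat_mem_omega (k + 1)⟩
  · obtain ⟨k, rfl⟩ := mem_omega.1 hx
    exact nat_mem_of_isInductive hv k

theorem isOmega_iff {w : V} : IsOmega w ↔ w = omega V :=
  ⟨fun h => set_ext fun x => ⟨h.2 _ isOmega_omega.1 x, isOmega_omega.2 _ h.1 x⟩,
    fun h => h ▸ isOmega_omega⟩

theorem isSeq_iff {f a : V} : IsSeq f a ↔ IsFun f (omega V) a := by
  simp [IsSeq, isOmega_iff]

theorem mem_nat {k : ℕ} {x : V} : x ∈ nat V k ↔ ∃ i < k, x = nat V i := by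
  induction k with
  | zero => simp [nat]
  | succ k ih =>
    simp only [nat, mem_adj, ih, Nat.lt_succ_iff_lt_or_eq]
    grind

theorem IsFin.finite {a : V} (h : IsFin a) : {x | x ∈ a}.Finite := by
  obtain ⟨w, n, f, hw, hn, hf, honto⟩ := h
  rw [isOmega_iff] at hw
  subst hw
  obtain ⟨k, rfl⟩ := mem_omega.1 hn
  choose y hy using honto
  refine Set.Finite.of_finite_image (f := fun x => {n | App f n x})
    ((((Set.finite_Iio k).image (nat V)).powerset).subset ?_) ?_
  · rintro _ ⟨x, -, rfl⟩ n hn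
    obtain ⟨i, hi, rfl⟩ := mem_nat.1 (hf.mem_mem hn).1
    exact ⟨i, hi, rfl⟩
  · intro x hx x' hx' h
    exact hf.unique (hy x hx) ((Set.ext_iff.1 h _).1 (hy x hx))

theorem isFin_emp : IsFin (emp V) :=
  ⟨omega V, nat V 0, emp V, isOmega_omega, nat_mem_omega 0,
    ⟨fun p hp => (notMem_emp p hp).elim, fun x hx => (notMem_emp x hx).elim⟩,
    fun x hx => (notMem_emp x hx).elim⟩

theorem IsFin.adj {a : V} (h : IsFin a) (x : V) : IsFin (adj a x) := by
  obtain ⟨w, n, f, hw, hn, hf, honto⟩ := h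
  rw [isOmega_iff] at hw
  subst hw
  obtain ⟨k, rfl⟩ := mem_omega.1 hn
  have hk : nat V k ∉ nat V k := mem_irrefl _
  have happ : ∀ i y, App (SetModel.adj f (opair (nat V k) x)) i y ↔
      App f i y ∨ i = nat V k ∧ y = x := fun i y => by
    simp [app_iff, opair_inj]
  refine ⟨omega V, nat V (k + 1), SetModel.adj f (opair (nat V k) x), isOmega_omega,
    nat_mem_omega _, isFun_iff.2 ⟨fun p hp => ?_, fun i hi => ?_⟩, fun y hy => ?_⟩
  · rcases mem_adj.1 hp with hp | rfl
    · obtain ⟨i, y, hi, hy, rfl⟩ := (isFun_iff.1 hf).1 p hp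
      exact ⟨i, y, mem_adj.2 (.inl hi), mem_adj.2 (.inl hy), rfl⟩
    · exact ⟨_, _, mem_adj.2 (.inr rfl), mem_adj.2 (.inr rfl), rfl⟩
  · simp only [happ]
    rcases mem_adj.1 hi with hi | rfl
    · obtain ⟨y, hy, hu⟩ := hf.2 i hi
      refine ⟨y, .inl hy, fun y' hy' => ?_⟩
      rcases hy' with hy' | ⟨rfl, -⟩
      · exact hu y' hy'
      · exact (hk hi).elim
    · refine ⟨x, .inr ⟨rfl, rfl⟩, fun y' hy' => ?_⟩
      rcases hy' with hy' | ⟨-, rfl⟩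
      · exact (hk (hf.mem_mem hy').1).elim
      · rfl
  · rcases mem_adj.1 hy with hy | rfl
    · exact (honto y hy).imp fun i hi => (happ _ _).2 (.inl hi)
    · exact ⟨_, (happ _ _).2 (.inr ⟨rfl, rfl⟩)⟩

end SetTheory

end SetModel

namespace SetModel

section Recursion

variable {V : Type*} [Membership V V]

/-- `α` is an ordinal: a transitive set of transitive sets. -/
def IsOrdinal (α : V) : Prop :=
  (∀ β : V, β ∈ α → Sub β α) ∧ ∀ β : V, β ∈ α → ∀ γ : V, γ ∈ β → Sub γ β

instance {n : ℕ} (a : (Fin n → V) → V) [DefTerm a] : DefPred fun v => IsOrdinal (a v) :=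
  DefPred.subst₁ (P := IsOrdinal) (by unfold IsOrdinal; infer_instance) a

theorem IsOrdinal.mem {α β : V} (h : IsOrdinal α) (hβ : β ∈ α) : IsOrdinal β :=
  ⟨h.2 β hβ, fun γ hγ => h.2 γ (h.1 β hβ γ hγ)⟩

variable [hV : WFModel V]

theorem IsOrdinal.trichotomy {α β : V} (hα : IsOrdinal α) (hβ : IsOrdinal β) :
    α ∈ β ∨ α = β ∨ β ∈ α := by
  induction α using mem_induction generalizing β with | h α ihα => ?_
  induction β using mem_induction with | h β ihβ => ?_
  by_contra! hcon
  obtain ⟨h1, h2, h3⟩ := hcon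
  refine h2 (set_ext fun x => ⟨fun hx => ?_, fun hx => ?_⟩)
  · rcases ihα x hx (hα.mem hx) hβ with h | rfl | h
    · exact h
    · exact (h3 hx).elim
    · exact (h3 (hα.1 x hx β h)).elim
  · rcases ihβ x hx (hβ.mem hx) with h | rfl | h
    · exact (h1 (hβ.1 x hx α h)).elim
    · exact (h1 hx).elim
    · exact h

theorem IsOrdinal.mem_or_eq_of_sub {α β : V} (hα : IsOrdinal α) (hβ : IsOrdinal β)
    (h : Sub α β) : α ∈ β ∨ α = β := by
  rcases hα.trichotomy hβ with h' | h' | h'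
  · exact .inl h'
  · exact .inr h'
  · exact (mem_irrefl β (h β h')).elim

theorem IsOrdinal.adj {α : V} (h : IsOrdinal α) : IsOrdinal (adj α α) := by
  refine ⟨fun β hβ γ hγ => ?_, fun β hβ => ?_⟩
  · rcases mem_adj.1 hβ with hβ | rfl
    · exact mem_adj.2 (.inl (h.1 β hβ γ hγ))
    · exact mem_adj.2 (.inl hγ)
  · rcases mem_adj.1 hβ with hβ | rfl
    exacts [h.2 β hβ, h.1]

theorem isOrdinal_sUn {R : V} (h : ∀ α, α ∈ R → IsOrdinal α) : IsOrdinal (sUn R) := by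
  refine ⟨fun β hβ γ hγ => ?_, fun β hβ => ?_⟩
  · obtain ⟨α, hα, hβ⟩ := mem_sUn.1 hβ
    exact mem_sUn.2 ⟨α, hα, (h α hα).1 β hβ γ hγ⟩
  · obtain ⟨α, hα, hβ⟩ := mem_sUn.1 hβ
    exact (h α hα).2 β hβ

/-! ### Monotone inductive definitions -/

section Inductive

variable (S : V) (step : V → V → Prop)

/-- Every `⟨α, s⟩ ∈ w` is justified: `step` leads to `s` from points that `w` puts at stages
below `α`. -/
def IsDerivation (w : V) : Prop :=
  ∀ α s : V, App w α s → s ∈ S ∧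
    ∃ A : V, (∀ t : V, t ∈ A → ∃ β : V, β ∈ α ∧ App w β t) ∧ step s A

/-- `s` is obtained by iterating `step` up to stage `α`. -/
def AtStage (α s : V) : Prop := IsOrdinal α ∧ ∃ w : V, IsDerivation S step w ∧ App w α s

/-- `α` is the first stage at which `s` is obtained. -/
def FirstStage (α s : V) : Prop :=
  AtStage S step α s ∧ ∀ β : V, β ∈ α → ¬ AtStage S step β s

variable {S step}

theorem AtStage.exists_firstStage {α s : V} (h : AtStage S step α s) :
    ∃ β, FirstStage S step β s := by
  induction α using mem_induction with | h α ih => ?_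
  by_cases hβ : ∃ β, β ∈ α ∧ AtStage S step β s
  · obtain ⟨β, h1, h2⟩ := hβ
    exact ih β h1 h2
  · exact ⟨α, h, fun β h1 h2 => hβ ⟨β, h1, h2⟩⟩

theorem FirstStage.le {α β s : V} (h : FirstStage S step α s) (h' : AtStage S step β s) :
    α ∈ β ∨ α = β := by
  rcases h.1.1.trichotomy h'.1 with h1 | h1 | h1
  · exact .inl h1
  · exact .inr h1
  · exact (h.2 β h1 h').elim

theorem FirstStage.unique {α β s : V} (h : FirstStage S step α s) (h' : FirstStage S step β s) :
    α = β := by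
  rcases h.le h'.1 with h1 | h1
  · exact (h'.2 α h1 h.1).elim
  · exact h1

variable (S step) in
/-- A definable monotone operator has a closed set all of whose elements are obtained by iteration,
along a relation that is well-founded outside the model as well. -/
theorem exists_inductive_set [hstep : DefPred fun v : Fin 2 → V => step (v 0) (v 1)] :
    ∃ I L : V, Sub I S ∧ (∀ s, s ∈ S → step s I → s ∈ I) ∧
      WellFounded (fun t s : V => App L t s) ∧
      ∀ s, s ∈ I → ∃ A : V, (∀ t, t ∈ A → t ∈ I ∧ App L t s) ∧ step s A := by
  have i1 := fun {n : ℕ} (s t : (Fin n → V) → V) [DefTerm s] [DefTerm t] => hstep.subst₂ s t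
  have i2 : DefPred fun v : Fin 2 → V => AtStage S step (v 0) (v 1) := by
    unfold AtStage IsDerivation; infer_instance
  have i3 := fun {n : ℕ} (s t : (Fin n → V) → V) [DefTerm s] [DefTerm t] => i2.subst₂ s t
  have i4 : DefPred fun v : Fin 2 → V => FirstStage S step (v 0) (v 1) := by
    unfold FirstStage; infer_instance
  have i5 := fun {n : ℕ} (s t : (Fin n → V) → V) [DefTerm s] [DefTerm t] => i4.subst₂ s t
  let I := sep S fun s => ∃ α, AtStage S step α s
  obtain ⟨L, -, hL⟩ := exists_relation I I
    fun t s => ∃ a b, FirstStage S step a t ∧ FirstStage S step b s ∧ a ∈ b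
  have hI : ∀ s, s ∈ I → ∃ a, FirstStage S step a s := fun s hs =>
    (mem_sep.1 hs).2.elim fun α h => h.exists_firstStage
  have memI : ∀ {α s}, AtStage S step α s → s ∈ I := fun {α s} h => by
    obtain ⟨hα, w, hw, h'⟩ := id h
    exact mem_sep.2 ⟨(hw α s h').1, α, h⟩
  refine ⟨I, L, fun s hs => (mem_sep.1 hs).1, fun s hs hsI => ?_, ?_, fun s hs => ?_⟩
  · obtain ⟨R, hR⟩ := exists_image I (fun s a => FirstStage S step a s) fun s hs => by
      obtain ⟨a, ha⟩ := hI s hs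
      exact ⟨a, ha, fun b hb => hb.unique ha⟩
    have hδ : IsOrdinal (sUn R) := isOrdinal_sUn fun a ha => by
      obtain ⟨t, -, h⟩ := (hR a).1 ha
      exact h.1.1
    obtain ⟨α, hα⟩ : ∃ α, α = adj (sUn R) (sUn R) := ⟨_, rfl⟩
    have hαo : IsOrdinal α := hα ▸ hδ.adj
    have hlt : ∀ t, t ∈ I → ∃ a, a ∈ α ∧ AtStage S step a t := fun t ht => by
      obtain ⟨a, ha⟩ := hI t ht
      refine ⟨a, ?_, ha.1⟩
      rw [hα, mem_adj]
      exact ha.1.1.mem_or_eq_of_sub hδ fun x hx => mem_sUn.2 ⟨a, (hR a).2 ⟨t, ht, ha⟩, hx⟩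
    obtain ⟨w, -, hw⟩ := exists_relation (adj α α) S
      fun β t => (β ∈ α ∧ AtStage S step β t) ∨ (β = α ∧ t = s)
    have hw' : ∀ {β t}, β ∈ α → AtStage S step β t → App w β t := fun {β t} h1 h2 =>
      (hw β t).2 ⟨mem_adj.2 (.inl h1), (mem_sep.1 (memI h2)).1, .inl ⟨h1, h2⟩⟩
    refine memI (α := α) ⟨hαo, w, fun β t h => ?_,
      (hw α s).2 ⟨mem_adj.2 (.inr rfl), hs, .inr ⟨rfl, rfl⟩⟩⟩
    obtain ⟨-, ht, ⟨hβ, -, w', hw1, h⟩ | ⟨rfl, rfl⟩⟩ := (hw β t).1 h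
    · obtain ⟨-, A, hA, hst⟩ := hw1 β t h
      refine ⟨ht, A, fun t' ht' => ?_, hst⟩
      obtain ⟨γ, hγ, h'⟩ := hA t' ht'
      have hγα := hαo.1 β hβ γ hγ
      exact ⟨γ, hγ, hw' hγα ⟨hαo.mem hγα, w', hw1, h'⟩⟩
    · exact ⟨ht, I, fun t' ht' => let ⟨a, h1, h2⟩ := hlt t' ht'; ⟨a, h1, hw' h1 h2⟩, hsI⟩
  · have key : ∀ b s, FirstStage S step b s → Acc (fun t s : V => App L t s) s := by
      intro b
      induction b using mem_induction with | h b ih => ?_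
      refine fun s hs => ⟨_, fun t ht => ?_⟩
      obtain ⟨-, -, a, b', ha, hb, hab⟩ := (hL t s).1 ht
      exact ih a (hb.unique hs ▸ hab) t ha
    refine ⟨fun s => ⟨_, fun t ht => ?_⟩⟩
    obtain ⟨-, -, a, b', ha, -⟩ := (hL t s).1 ht
    exact key a t ha
  · obtain ⟨b, hb⟩ := hI s hs
    obtain ⟨hbo, w, hw, h⟩ := hb.1
    obtain ⟨-, A, hA, hst⟩ := hw b s h
    refine ⟨A, fun t ht => ?_, hst⟩
    obtain ⟨β, hβ, h'⟩ := hA t ht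
    have hβt : AtStage S step β t := ⟨hbo.mem hβ, w, hw, h'⟩
    obtain ⟨a, ha⟩ := hβt.exists_firstStage
    refine ⟨memI hβt, (hL t s).2 ⟨memI hβt, hs, a, b, ha, hb, ?_⟩⟩
    rcases ha.le hβt with h1 | rfl
    · exact hbo.1 β hβ a h1
    · exact hβ

end Inductive

/-! ### Dependent choice -/

theorem exists_dependent_sequence (S s₀ : V) (R : V → V → V → Prop)
    [hR' : DefPred fun v : Fin 3 → V => R (v 0) (v 1) (v 2)] (h₀ : s₀ ∈ S)
    (hR : ∀ k s, s ∈ S → ∃ t, t ∈ S ∧ R (nat V k) s t) :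
    ∃ s : ℕ → V, s 0 = s₀ ∧ (∀ k, s k ∈ S) ∧ (∀ k, R (nat V k) (s k) (s (k + 1))) ∧
      ∃ H : V, ∀ x, x ∈ H ↔ ∃ k, x = s k := by
  have := fun {n : ℕ} (a b c : (Fin n → V) → V) [DefTerm a] [DefTerm b] [DefTerm c] =>
    hR'.subst₃ a b c
  obtain ⟨c, hc, hcR⟩ := exists_choice (prod (omega V) S) S
    (fun p t => ∃ n s, IsOPair p n s ∧ R n s t) fun p hp => by
      obtain ⟨n, s, hn, hs, rfl⟩ := mem_prod.1 hp
      obtain ⟨k, rfl⟩ := mem_omega.1 hn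
      obtain ⟨t, ht, h⟩ := hR k s hs
      exact ⟨t, ht, _, _, isOPair_iff.2 rfl, h⟩
  choose! g hg using fun (k : ℕ) (s : V) (hs : s ∈ S) =>
    hc.exists_app (x := opair (nat V k) s) (opair_mem_prod.2 ⟨nat_mem_omega k, hs⟩)
  let s : ℕ → V := fun k => Nat.rec s₀ (fun k x => g k x) k
  have hs : ∀ k, s k ∈ S := fun k => by
    induction k with
    | zero => exact h₀
    | succ k ih => exact (hc.mem_mem (hg k (s k) ih)).2
  have happ : ∀ k, App c (opair (nat V k) (s k)) (s (k + 1)) := fun k => hg k (s k) (hs k)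
  refine ⟨s, rfl, hs, fun k => ?_, sep S fun x => ∃ u n : V, App u n x ∧
    ∀ n x, App u n x → (IsEmptySet n ∧ x = s₀) ∨ ∃ m y p, App u m y ∧ IsSucc n m ∧
      IsOPair p m y ∧ App c p x, fun x => ?_⟩
  · obtain ⟨n, x, e, h⟩ := hcR _ _ (happ k)
    obtain ⟨rfl, rfl⟩ := opair_inj.1 (isOPair_iff.1 e)
    exact h
  · rw [mem_sep]
    constructor
    · rintro ⟨-, u, n, hx, hu⟩
      have : ∀ n x, App u n x → ∃ k, n = nat V k ∧ x = s k := by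
        intro n
        induction n using mem_induction with | h n ih => ?_
        intro x hx
        rcases hu n x hx with ⟨h1, rfl⟩ | ⟨m, y, p, h1, h2, h3, h4⟩
        · exact ⟨0, isEmptySet_iff.1 h1, rfl⟩
        · rw [isSucc_iff] at h2
          subst h2
          obtain ⟨k, rfl, rfl⟩ := ih m (mem_adj.2 (.inr rfl)) y h1
          rw [isOPair_iff.1 h3] at h4
          exact ⟨k + 1, rfl, hc.unique h4 (happ k)⟩
      obtain ⟨k, -, h⟩ := this n x hx
      exact ⟨k, h⟩
    · rintro ⟨k, rfl⟩
      refine ⟨hs k, ?_⟩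
      suffices ∃ u : V, App u (nat V k) (s k) ∧
          ∀ n x, App u n x → (IsEmptySet n ∧ x = s₀) ∨ ∃ m y p, App u m y ∧ IsSucc n m ∧
            IsOPair p m y ∧ App c p x by
        obtain ⟨u, hu⟩ := this
        exact ⟨u, _, hu⟩
      induction k with
      | zero =>
        refine ⟨adj (emp V) (opair (nat V 0) s₀), app_iff.2 (mem_adj.2 (.inr rfl)),
          fun n x h => .inl ?_⟩
        simp only [app_iff, mem_adj, notMem_emp, false_or, opair_inj] at h
        exact ⟨isEmptySet_iff.2 h.1, h.2⟩
      | succ k ih =>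
        obtain ⟨u, hu, hu'⟩ := ih
        have hmono : ∀ n x, App u n x → App (adj u (opair (nat V (k + 1)) (s (k + 1)))) n x :=
          fun n x h => app_iff.2 (mem_adj.2 (.inl (app_iff.1 h)))
        refine ⟨adj u (opair (nat V (k + 1)) (s (k + 1))), app_iff.2 (mem_adj.2 (.inr rfl)),
          fun n x h => ?_⟩
        rcases mem_adj.1 (app_iff.1 h) with h | h
        · rcases hu' n x (app_iff.2 h) with h | ⟨m, y, p, h1, h2⟩
          · exact .inl h
          · exact .inr ⟨m, y, p, hmono _ _ h1, h2⟩
        · obtain ⟨rfl, rfl⟩ := opair_inj.1 h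
          exact .inr ⟨_, _, _, hmono _ _ hu, isSucc_iff.2 rfl, isOPair_iff.2 rfl, happ k⟩

end Recursion

end SetModel

namespace SetModel

section Borel

variable {V : Type*} [Membership V V]

/-- `B = X \ ⋃ {f(n) : n ∈ ω}`. -/
def IsAvoiding (X f B : V) : Prop :=
  ∀ x : V, x ∈ B ↔ x ∈ X ∧ ∀ n C : V, App f n C → x ∉ C

instance {n : ℕ} (a b c : (Fin n → V) → V) [DefTerm a] [DefTerm b] [DefTerm c] :
    DefPred fun v => IsAvoiding (a v) (b v) (c v) :=
  DefPred.subst₃ (P := IsAvoiding) (by unfold IsAvoiding; infer_instance) a b c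

variable [hV : WFModel V]

/-- The set of all sequences of elements of `a`. -/
noncomputable def seqs (a : V) : V := sep (pow (prod (omega V) a)) fun f => IsSeq f a

@[simp] theorem mem_seqs {a f : V} : f ∈ seqs a ↔ IsSeq f a := by
  simp only [seqs, mem_sep, mem_pow, and_iff_right_iff_imp]
  intro h p hp
  obtain ⟨x, y, hx, hy, rfl⟩ := (isFun_iff.1 (isSeq_iff.1 h)).1 p hp
  exact opair_mem_prod.2 ⟨hx, hy⟩

theorem exists_const_seq {a B : V} (hB : B ∈ a) :
    ∃ f, IsSeq f a ∧ ∀ n C, App f n C ↔ n ∈ omega V ∧ C = B := by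
  obtain ⟨f, hf, h⟩ := exists_function (omega V) a (fun _ C => C = B)
    fun n _ => ⟨B, ⟨hB, rfl⟩, fun y hy => hy.2⟩
  refine ⟨f, isSeq_iff.2 hf, fun n C => (h n C).trans ?_⟩
  grind

theorem IsSeq.mem {f a n C : V} (h : IsSeq f a) (hC : App f n C) : C ∈ a :=
  ((isSeq_iff.1 h).mem_mem hC).2

/-- A Borel set that is not open is the complement of the union of a sequence of Borel sets that
are smaller for a well-founded relation. -/
theorem IsBorelAlg.exists_presentation {X τ 𝓑 : V} (h : IsBorelAlg X τ 𝓑) (hX : X ∈ τ) :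
    ∃ F L : V, WellFounded (fun C B : V => App L C B) ∧ IsFun F 𝓑 (seqs 𝓑) ∧
      ∀ B f, App F B f → B ∉ τ →
        IsAvoiding X f B ∧ ∀ n C, App f n C → App L C B := by
  obtain ⟨hσ, hτ, hmin⟩ := h
  obtain ⟨I, L, hI, hclosed, hwf, hstep⟩ := exists_inductive_set 𝓑
    fun B A => B ∈ τ ∨ ∃ f, IsSeq f A ∧ IsAvoiding X f B
  have hdiff : ∀ B C, B ∈ I → IsDiff C X B → C ∈ I := fun B C hB hC => by
    obtain ⟨C', hC', hC'𝓑⟩ := hσ.2.2.1 B (hI B hB)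
    obtain rfl : C' = C := set_ext fun x => (hC' x).trans (hC x).symm
    obtain ⟨f, hf, hfB⟩ := exists_const_seq hB
    refine hclosed C' hC'𝓑 (.inr ⟨f, hf, fun x => (hC x).trans ?_⟩)
    simp only [hfB]
    exact ⟨fun ⟨h1, h2⟩ => ⟨h1, fun n C ⟨_, e⟩ => e ▸ h2⟩,
      fun ⟨h1, h2⟩ => ⟨h1, h2 _ _ ⟨nat_mem_omega 0, rfl⟩⟩⟩
  have h𝓑 : Sub 𝓑 I := by
    refine hmin I ⟨fun B hB => hσ.1 B (hI B hB), hclosed X (hτ X hX) (.inl hX), fun B hB => ?_,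
      fun f hf => ?_⟩ fun O hO => hclosed O (hτ O hO) (.inl hO)
    · obtain ⟨C, hC, -⟩ := hσ.2.2.1 B (hI B hB)
      exact ⟨C, hC, hdiff B C hB hC⟩
    · obtain ⟨U, hU, hU𝓑⟩ := hσ.2.2.2 f (isSeq_iff.2 ((isSeq_iff.1 hf).mono hI))
      obtain ⟨C, hC, hC𝓑⟩ := hσ.2.2.1 U hU𝓑
      have hCI : C ∈ I := hclosed C hC𝓑 <| .inr ⟨f, hf, fun x => by
        rw [hC x, hU x]
        push Not
        rfl⟩
      refine ⟨U, hU, hdiff C U hCI fun x => ?_⟩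
      have := hσ.1 U hU𝓑 x
      rw [hC x]
      tauto
  obtain ⟨F, hF, hF'⟩ := exists_choice 𝓑 (seqs 𝓑)
    (fun B f => B ∉ τ → IsAvoiding X f B ∧ ∀ n C, App f n C → App L C B) fun B hB => by
      obtain ⟨A, hA, hB' | ⟨f, hf, hfB⟩⟩ := hstep B (h𝓑 B hB)
      · obtain ⟨f, hf, -⟩ := exists_const_seq hB
        exact ⟨f, mem_seqs.2 hf, fun hn => (hn hB').elim⟩
      · exact ⟨f, mem_seqs.2 (isSeq_iff.2 ((isSeq_iff.1 hf).mono fun t ht => hI t (hA t ht).1)),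
          fun _ => ⟨hfB, fun n C hC => (hA C (hf.mem hC)).2⟩⟩
  exact ⟨F, L, hwf, hF, hF'⟩

end Borel

end SetModel

namespace SetModel

section Topology

variable {V : Type*} [Membership V V]

/-- The closure of `P` in `⟨K, κ⟩` is a subset of `W`. -/
def IsWellInside (K κ P W : V) : Prop :=
  ∃ U : V, U ∈ κ ∧ Disj P U ∧ ∀ x : V, x ∈ K → x ∈ U ∨ x ∈ W

instance {n : ℕ} (a b c d : (Fin n → V) → V) [DefTerm a] [DefTerm b] [DefTerm c] [DefTerm d] :
    DefPred fun v => IsWellInside (a v) (b v) (c v) (d v) :=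
  DefPred.subst₄ (P := IsWellInside) (by unfold IsWellInside; infer_instance) a b c d

theorem IsWellInside.mono {K κ P W P' : V} (h : IsWellInside K κ P W) (hP : Sub P' P) :
    IsWellInside K κ P' W :=
  let ⟨U, hU, hd, hc⟩ := h
  ⟨U, hU, fun x hx => hd x (hP x hx), hc⟩

/-- `t` is a filter of open sets of `⟨X, τ⟩` that is prime for the unions of the model. -/
structure IsPrimeFilter (X τ : V) (t : V → Prop) : Prop where
  whole : t X
  inter : ∀ O P Q : V, O ∈ τ → P ∈ τ → Q ∈ τ → IsInter Q O P → (t Q ↔ t O ∧ t P)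
  union : ∀ D O : V, Sub D τ → O ∈ τ → IsUnion O D → t O → ∃ P : V, P ∈ D ∧ t P

theorem IsPrimeFilter.mono {X τ O P : V} {t : V → Prop} (h : IsPrimeFilter X τ t) (hO : O ∈ τ)
    (hP : P ∈ τ) (hOP : Sub O P) (ht : t O) : t P :=
  ((h.inter O P O hO hP hO fun x => ⟨fun hx => ⟨hx, hOP x hx⟩, And.left⟩).1 ht).2

variable [hV : WFModel V]

/-- `a ∩ b`. -/
noncomputable def inter (a b : V) : V := sep a fun x => x ∈ b

@[simp] theorem mem_inter {a b x : V} : x ∈ inter a b ↔ x ∈ a ∧ x ∈ b := mem_sep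

theorem IsTop.inter_mem {K κ O P : V} (h : IsTop K κ) (hO : O ∈ κ) (hP : P ∈ κ) :
    inter O P ∈ κ := by
  obtain ⟨Q, hQ, hQκ⟩ := h.2.2.1 O P hO hP
  rwa [show inter O P = Q from set_ext fun x => mem_inter.trans (hQ x).symm]

theorem IsTop.sUn_mem {K κ D : V} (h : IsTop K κ) (hD : Sub D κ) : sUn D ∈ κ := by
  obtain ⟨U, hU, hUκ⟩ := h.2.2.2 D hD
  rwa [show sUn D = U from set_ext fun x => mem_sUn.trans (hU x).symm]

theorem IsCompactTop.exists_finite {K κ D : V} (h : IsCompactTop K κ) (hK : IsTop K κ)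
    (hD : Sub D κ) (hc : ∀ x : V, x ∈ K → ∃ U : V, U ∈ D ∧ x ∈ U) :
    ∃ T : Set V, T.Finite ∧ (∀ U ∈ T, U ∈ D) ∧ ∀ x : V, x ∈ K → ∃ U ∈ T, x ∈ U := by
  obtain ⟨F, hF, hFD, hFK⟩ := h D hD fun x =>
    ⟨hc x, fun ⟨U, hU, hx⟩ => hK.1 U (hD U hU) x hx⟩
  exact ⟨_, hF.finite, hFD, fun x hx => (hFK x).1 hx⟩

theorem exists_isWellInside {K κ W x : V} (hK : IsTop K κ) (hH : IsHausdorff K κ)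
    (hc : IsCompactTop K κ) (hW : W ∈ κ) (hx : x ∈ W) :
    ∃ P : V, P ∈ κ ∧ x ∈ P ∧ IsWellInside K κ P W := by
  have hxK := hK.1 W hW x hx
  let D := sep κ fun U => U = W ∨ ∃ P, P ∈ κ ∧ x ∈ P ∧ Disj P U
  obtain ⟨T, hT, hTD, hTK⟩ := hc.exists_finite hK (D := D) (fun U hU => (mem_sep.1 hU).1)
    fun y hy => by
      by_cases h : x = y
      · exact ⟨W, mem_sep.2 ⟨hW, .inl rfl⟩, h ▸ hx⟩
      · obtain ⟨P, U, hP, hU, hxP, hyU, hd⟩ := hH x y hxK hy h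
        exact ⟨U, mem_sep.2 ⟨hU, .inr ⟨P, hP, hxP, hd⟩⟩, hyU⟩
  obtain ⟨P, U, hP, hxP, hU, hd, hTU⟩ : ∃ P U : V, P ∈ κ ∧ x ∈ P ∧ U ∈ κ ∧ Disj P U ∧
      ∀ U' ∈ T, U' = W ∨ Sub U' U := by
    clear hTK
    induction T, hT using Set.Finite.induction_on with
    | empty =>
      refine ⟨K, sUn (emp V), hK.2.1, hxK, hK.sUn_mem fun y hy => (notMem_emp y hy).elim,
        fun y _ hy => ?_, fun U' hU' => hU'.elim⟩
      obtain ⟨z, hz, -⟩ := mem_sUn.1 hy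
      exact notMem_emp z hz
    | @insert U' T _ _ ih =>
      obtain ⟨P, U, hP, hxP, hU, hd, hTU⟩ := ih fun U hU => hTD U (.inr hU)
      obtain ⟨hU'κ, rfl | ⟨P', hP', hxP', hd'⟩⟩ := mem_sep.1 (hTD U' (.inl rfl))
      · refine ⟨P, U, hP, hxP, hU, hd, fun U' hU' => ?_⟩
        rcases hU' with rfl | hU'
        exacts [.inl rfl, hTU U' hU']
      · refine ⟨inter P P', sUn (upair U U'), hK.inter_mem hP hP', mem_inter.2 ⟨hxP, hxP'⟩,
          hK.sUn_mem fun y hy => ?_, fun y hy hy' => ?_, fun U₁ hU₁ => ?_⟩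
        · rcases mem_upair.1 hy with rfl | rfl <;> assumption
        · obtain ⟨z, hz, hyz⟩ := mem_sUn.1 hy'
          rw [mem_inter] at hy
          rcases mem_upair.1 hz with rfl | rfl
          exacts [hd y hy.1 hyz, hd' y hy.2 hyz]
        · rcases hU₁ with rfl | hU₁
          · exact .inr fun y hy => mem_sUn.2 ⟨_, mem_upair.2 (.inr rfl), hy⟩
          · exact (hTU U₁ hU₁).imp_right fun h y hy =>
              mem_sUn.2 ⟨_, mem_upair.2 (.inl rfl), h y hy⟩
  refine ⟨P, hP, hxP, U, hU, hd, fun y hy => ?_⟩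
  obtain ⟨U', hU', hyU'⟩ := hTK y hy
  rcases hTU U' hU' with rfl | h
  exacts [.inr hyU', .inl (h y hyU')]

variable (V) in
/-- A topological space `⟨X, τ⟩` as the image of a `G_δ` subspace `Y = ⋂ G(n)` of a compact
Hausdorff space `⟨K, κ⟩` under a continuous open map `φ`, and a presentation `F` of its Borel sets
that are not open as complements of countable unions, along a well-founded relation `L`. -/
structure Presentation where
  (X τ 𝓑 K κ Y G φ F L : V)
  topX : IsTop X τ
  topK : IsTop K κ
  hausdorff : IsHausdorff K κ
  compact : IsCompactTop K κ
  seq_G : IsSeq G κ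
  inter_G : IsSeqInter Y G
  Y_sub : Sub Y K
  fun_φ : IsFun φ Y X
  onto_φ : IsOnto φ X
  image : ∀ P : V, P ∈ κ → ∃ O : V, O ∈ τ ∧ ∀ x : V, x ∈ O ↔ ∃ y : V, y ∈ P ∧ y ∈ Y ∧ App φ y x
  preimage : ∀ O : V, O ∈ τ → ∃ U : V, U ∈ κ ∧
    ∀ y : V, y ∈ Y → (y ∈ U ↔ ∃ x : V, x ∈ O ∧ App φ y x)
  sigma : IsSigmaAlg X 𝓑
  τ_sub : Sub τ 𝓑
  wf : WellFounded fun C B : V => App L C B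
  fun_F : IsFun F 𝓑 (seqs 𝓑)
  avoiding : ∀ B f : V, App F B f → B ∉ τ → IsAvoiding X f B ∧ ∀ n C : V, App f n C → App L C B

theorem IsInterpretable.exists_presentation {X τ 𝓑 : V} (h : IsInterpretable X τ)
    (h𝓑 : IsBorelAlg X τ 𝓑) : ∃ 𝔖 : Presentation V, 𝔖.X = X ∧ 𝔖.τ = τ ∧ 𝔖.𝓑 = 𝓑 := by
  obtain ⟨hX, -, -, Y, σ, φ, ⟨K, κ, hK, hH, hc, ⟨hYK, G, hG, hYG⟩, hσ⟩, hφ, honto, hcont, hopen⟩ := h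
  obtain ⟨F, L, hwf, hF, hF'⟩ := h𝓑.exists_presentation hX.2.1
  refine ⟨⟨X, τ, 𝓑, K, κ, Y, G, φ, F, L, hX, hK, hH, hc, hG, hYG, hYK, hφ, honto, fun P hP => ?_,
    fun O hO => ?_, h𝓑.1, h𝓑.2.1, hwf, hF, hF'⟩, rfl, rfl, rfl⟩
  · obtain ⟨O, hO, hOτ⟩ := hopen (inter P Y) ((hσ _).2 ⟨P, hP, fun x => mem_inter⟩)
    refine ⟨O, hOτ, fun x => (hO x).trans ?_⟩
    simp only [mem_inter, and_assoc]
  · obtain ⟨S, hS, hSσ⟩ := hcont O hO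
    obtain ⟨U, hU, hSU⟩ := (hσ S).1 hSσ
    refine ⟨U, hU, fun y hy => ?_⟩
    have h1 := hS y
    have h2 := hSU y
    simp only [hy, true_and, and_true] at h1 h2
    exact h2.symm.trans h1

namespace Presentation

variable (𝔖 : Presentation V)

/-- The image of `P ∩ Y` in `X`. -/
noncomputable def img (P : V) : V :=
  sep 𝔖.X fun x => ∃ y, y ∈ P ∧ y ∈ 𝔖.Y ∧ App 𝔖.φ y x

theorem mem_img {P x : V} : x ∈ 𝔖.img P ↔ ∃ y, y ∈ P ∧ y ∈ 𝔖.Y ∧ App 𝔖.φ y x := by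
  simp only [img, mem_sep, and_iff_right_iff_imp]
  rintro ⟨y, -, -, h⟩
  exact (𝔖.fun_φ.mem_mem h).2

theorem img_mem {P : V} (hP : P ∈ 𝔖.κ) : 𝔖.img P ∈ 𝔖.τ := by
  obtain ⟨O, hO, h⟩ := 𝔖.image P hP
  rwa [show 𝔖.img P = O from set_ext fun x => 𝔖.mem_img.trans (h x).symm]

theorem img_K : 𝔖.img 𝔖.K = 𝔖.X := by
  refine set_ext fun x => ⟨fun h => (mem_sep.1 h).1, fun h => ?_⟩
  obtain ⟨y, hy⟩ := 𝔖.onto_φ x h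
  have hyY := (𝔖.fun_φ.mem_mem hy).1
  exact 𝔖.mem_img.2 ⟨y, 𝔖.Y_sub y hyY, hyY, hy⟩

variable {𝔖} {t : V → Prop}

/-- An open set whose image belongs to the filter can be shrunk. -/
theorem exists_shrink (ht : IsPrimeFilter 𝔖.X 𝔖.τ t) {P W : V} (hP : P ∈ 𝔖.κ) (hW : W ∈ 𝔖.κ)
    (h : t (𝔖.img (inter P W))) : ∃ P', P' ∈ 𝔖.κ ∧ Sub P' P ∧ IsWellInside 𝔖.K 𝔖.κ P' W ∧
      t (𝔖.img P') := by
  let D := sep 𝔖.τ fun O => ∃ P', P' ∈ 𝔖.κ ∧ Sub P' P ∧ IsWellInside 𝔖.K 𝔖.κ P' W ∧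
    ∀ x, x ∈ O ↔ ∃ y, y ∈ P' ∧ y ∈ 𝔖.Y ∧ App 𝔖.φ y x
  have hD : Sub D 𝔖.τ := fun O hO => (mem_sep.1 hO).1
  have hU := 𝔖.topX.sUn_mem hD
  obtain ⟨O, hO, htO⟩ := ht.union D (sUn D) hD hU (fun x => mem_sUn) <|
    ht.mono (𝔖.img_mem (𝔖.topK.inter_mem hP hW)) hU (fun x hx => by
      obtain ⟨y, hy, hyY, hyx⟩ := 𝔖.mem_img.1 hx
      rw [mem_inter] at hy
      obtain ⟨P', hP', hyP', hin⟩ := exists_isWellInside 𝔖.topK 𝔖.hausdorff 𝔖.compact hW hy.2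
      have hPP' := 𝔖.topK.inter_mem hP' hP
      exact mem_sUn.2 ⟨𝔖.img (inter P' P), mem_sep.2 ⟨𝔖.img_mem hPP', inter P' P, hPP',
        fun y hy => (mem_inter.1 hy).2, hin.mono fun y hy => (mem_inter.1 hy).1,
        fun x => 𝔖.mem_img⟩, 𝔖.mem_img.2 ⟨y, mem_inter.2 ⟨hyP', hy.1⟩, hyY, hyx⟩⟩) h
  obtain ⟨-, P', hP', hsub, hin, he⟩ := mem_sep.1 hO
  refine ⟨P', hP', hsub, hin, ?_⟩
  rwa [show 𝔖.img P' = O from set_ext fun x => 𝔖.mem_img.trans (he x).symm]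

end Presentation

end Topology

end SetModel

namespace SetModel

section Consistency

variable {V : Type*} [Membership V V] [hV : WFModel V]

namespace Presentation

variable (𝔖 : Presentation V)

/-- `P` and the set `a` of excluded sequences force membership in the Borel set `E`. -/
def Forces (E P a : V) : Prop :=
  (E ∈ 𝔖.τ ∧ ∃ U : V, U ∈ 𝔖.κ ∧ (∀ y x : V, y ∈ U → y ∈ 𝔖.Y → App 𝔖.φ y x → x ∈ E) ∧
    IsWellInside 𝔖.K 𝔖.κ P U) ∨ (E ∉ 𝔖.τ ∧ ∃ h : V, App 𝔖.F E h ∧ h ∈ a)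

/-- `P` and `a` force membership in one of the sets whose union is the complement of `C`. -/
def Refutes (C P a : V) : Prop :=
  ∃ h k E : V, App 𝔖.F C h ∧ App h k E ∧ 𝔖.Forces E P a

/-- `P` has a point which is in none of the open sets excluded by `a`. -/
def HasPoint (P a : V) : Prop :=
  ∃ y x : V, y ∈ P ∧ y ∈ 𝔖.Y ∧ App 𝔖.φ y x ∧
    ∀ g m O : V, g ∈ a → App g m O → O ∈ 𝔖.τ → x ∉ O

/-- The set of all pairs of an open subset of `K` and a finite set of sequences of Borel sets. -/
noncomputable def conds : V := prod 𝔖.κ (sep (pow (seqs 𝔖.𝓑)) IsFin)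

/-- The operator whose fixed point is the set of inconsistent conditions. -/
def BadStep (s A : V) : Prop :=
  ∃ P a : V, IsOPair s P a ∧ (¬ 𝔖.HasPoint P a ∨
    (∃ n W : V, App 𝔖.G n W ∧ ∀ s' P' a' : V, s' ∈ 𝔖.conds → IsOPair s' P' a' → Sub P' P →
      Sub a a' → IsWellInside 𝔖.K 𝔖.κ P' W → s' ∈ A) ∨
    ∃ g m C : V, g ∈ a ∧ App g m C ∧ C ∉ 𝔖.τ ∧ ∀ s' P' a' : V, s' ∈ 𝔖.conds →
      IsOPair s' P' a' → Sub P' P → Sub a a' → 𝔖.Refutes C P' a' → s' ∈ A)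

section Definability

variable {n : ℕ} (a b c : (Fin n → V) → V) [DefTerm a] [DefTerm b] [DefTerm c]

instance : DefPred fun v => 𝔖.Forces (a v) (b v) (c v) :=
  DefPred.subst₃ (P := 𝔖.Forces) (by unfold Forces; infer_instance) a b c

instance : DefPred fun v => 𝔖.Refutes (a v) (b v) (c v) :=
  DefPred.subst₃ (P := 𝔖.Refutes) (by unfold Refutes; infer_instance) a b c

instance : DefPred fun v => 𝔖.HasPoint (a v) (b v) :=
  DefPred.subst₂ (P := 𝔖.HasPoint) (by unfold HasPoint; infer_instance) a b

instance : DefPred fun v => 𝔖.BadStep (a v) (b v) :=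
  DefPred.subst₂ (P := 𝔖.BadStep) (by unfold BadStep; infer_instance) a b

end Definability

variable {𝔖}

theorem mem_conds {P a : V} : opair P a ∈ 𝔖.conds ↔
    P ∈ 𝔖.κ ∧ (∀ g, g ∈ a → IsSeq g 𝔖.𝓑) ∧ IsFin a := by
  simp [conds, Sub]

theorem Forces.mono {E P a P' a' : V} (h : 𝔖.Forces E P a) (hP : Sub P' P) (ha : Sub a a') :
    𝔖.Forces E P' a' := by
  obtain ⟨hE, U, hU, h1, h2⟩ | ⟨hE, h, h1, h2⟩ := h
  · exact .inl ⟨hE, U, hU, h1, h2.mono hP⟩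
  · exact .inr ⟨hE, h, h1, ha h h2⟩

theorem Refutes.mono {C P a P' a' : V} (h : 𝔖.Refutes C P a) (hP : Sub P' P) (ha : Sub a a') :
    𝔖.Refutes C P' a' :=
  let ⟨h, k, E, h1, h2, h3⟩ := h
  ⟨h, k, E, h1, h2, h3.mono hP ha⟩

/-! ### Truth at a prime filter -/

/-- `T` is the set of Borel sets that contain the point given by the prime filter `t`. -/
structure IsTruth (𝔖 : Presentation V) (t T : V → Prop) : Prop where
  prime : IsPrimeFilter 𝔖.X 𝔖.τ t
  of_open : ∀ O, O ∈ 𝔖.τ → (T O ↔ t O)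
  of_not_open : ∀ B f, App 𝔖.F B f → B ∉ 𝔖.τ → (T B ↔ ∀ n C, App f n C → ¬ T C)

theorem exists_isTruth {t : V → Prop} (ht : IsPrimeFilter 𝔖.X 𝔖.τ t) : ∃ T, 𝔖.IsTruth t T := by
  let T : V → Prop := 𝔖.wf.fix fun B T => (B ∈ 𝔖.τ ∧ t B) ∨
    (B ∉ 𝔖.τ ∧ ∀ C (hC : App 𝔖.L C B), (∃ f n, App 𝔖.F B f ∧ App f n C) → ¬ T C hC)
  have hT : ∀ B, T B ↔ ((B ∈ 𝔖.τ ∧ t B) ∨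
      (B ∉ 𝔖.τ ∧ ∀ C, App 𝔖.L C B → (∃ f n, App 𝔖.F B f ∧ App f n C) → ¬ T C)) := fun B => by
    simp only [T]
    rw [WellFounded.fix_eq]
  refine ⟨T, ht, fun O hO => ?_, fun B f hf hB => ?_⟩
  · rw [hT]
    simp [hO]
  · rw [hT]
    simp only [hB, false_and, not_false_eq_true, true_and, false_or]
    constructor
    · exact fun h n C hC => h C ((𝔖.avoiding B f hf hB).2 n C hC) ⟨f, n, hf, hC⟩
    · rintro h C - ⟨f', n, hf', hC⟩
      obtain rfl := 𝔖.fun_F.unique hf hf'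
      exact h n C hC

/-- The condition `⟨P, a⟩` is true at the point given by the prime filter `t`. -/
structure IsTrueCond (𝔖 : Presentation V) (t T : V → Prop) (P a : V) : Prop where
  mem : opair P a ∈ 𝔖.conds
  img : t (𝔖.img P)
  excluded : ∀ g, g ∈ a → ∀ m C, App g m C → ¬ T C

variable {t T : V → Prop}

theorem IsTrueCond.shrink (hT : 𝔖.IsTruth t T) {P a W : V} (h : 𝔖.IsTrueCond t T P a)
    (hW : W ∈ 𝔖.κ) (h' : t (𝔖.img (inter P W))) :
    ∃ P', 𝔖.IsTrueCond t T P' a ∧ Sub P' P ∧ IsWellInside 𝔖.K 𝔖.κ P' W := by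
  have hm := mem_conds.1 h.mem
  obtain ⟨P', hP', h1, h2, h3⟩ := exists_shrink hT.prime hm.1 hW h'
  exact ⟨P', ⟨mem_conds.2 ⟨hP', hm.2⟩, h3, h.excluded⟩, h1, h2⟩

theorem IsTrueCond.insert {P a g : V} (h : 𝔖.IsTrueCond t T P a)
    (hg : IsSeq g 𝔖.𝓑) (hgT : ∀ m C, App g m C → ¬ T C) : 𝔖.IsTrueCond t T P (adj a g) := by
  have hm := mem_conds.1 h.mem
  refine ⟨mem_conds.2 ⟨hm.1, fun g' hg' => ?_, hm.2.2.adj g⟩, h.img, fun g' hg' => ?_⟩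
  · rcases mem_adj.1 hg' with hg' | rfl
    exacts [hm.2.1 g' hg', hg]
  · rcases mem_adj.1 hg' with hg' | rfl
    exacts [h.excluded g' hg', hgT]

theorem IsTrueCond.exists_forces (hT : 𝔖.IsTruth t T) {P a E : V} (h : 𝔖.IsTrueCond t T P a)
    (hE : E ∈ 𝔖.𝓑) (hTE : T E) :
    ∃ P' a', 𝔖.IsTrueCond t T P' a' ∧ Sub P' P ∧ Sub a a' ∧ 𝔖.Forces E P' a' := by
  by_cases hEτ : E ∈ 𝔖.τ
  · obtain ⟨U, hU, hUE⟩ := 𝔖.preimage E hEτ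
    have hP := (mem_conds.1 h.mem).1
    have hUE' : ∀ y x, y ∈ U → y ∈ 𝔖.Y → App 𝔖.φ y x → x ∈ E := fun y x hy hyY hyx => by
      obtain ⟨x', hx', hyx'⟩ := (hUE y hyY).1 hy
      rwa [𝔖.fun_φ.unique hyx hyx']
    have himg : t (𝔖.img (inter P U)) := by
      refine (hT.prime.inter _ _ _ (𝔖.img_mem hP) hEτ
        (𝔖.img_mem (𝔖.topK.inter_mem hP hU)) fun x => ?_).2 ⟨h.img, (hT.of_open E hEτ).1 hTE⟩
      simp only [mem_img, mem_inter]
      constructor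
      · rintro ⟨y, ⟨hyP, hyU⟩, hyY, hyx⟩
        exact ⟨⟨y, hyP, hyY, hyx⟩, hUE' y x hyU hyY hyx⟩
      · rintro ⟨⟨y, hyP, hyY, hyx⟩, hx⟩
        exact ⟨y, ⟨hyP, (hUE y hyY).2 ⟨x, hx, hyx⟩⟩, hyY, hyx⟩
    obtain ⟨P', h1, h2, h3⟩ := h.shrink hT hU himg
    exact ⟨P', a, h1, h2, fun _ => id, .inl ⟨hEτ, U, hU, hUE', h3⟩⟩
  · obtain ⟨f, hf⟩ := 𝔖.fun_F.exists_app hE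
    exact ⟨P, adj a f, h.insert (mem_seqs.1 (𝔖.fun_F.mem_mem hf).2) ((hT.of_not_open E f hf hEτ).1 hTE),
      fun _ => id, fun _ hx => mem_adj.2 (.inl hx), .inr ⟨hEτ, f, hf, mem_adj.2 (.inr rfl)⟩⟩

theorem IsTrueCond.hasPoint (hT : 𝔖.IsTruth t T) {P a : V} (h : 𝔖.IsTrueCond t T P a) :
    𝔖.HasPoint P a := by
  by_contra hcon
  let D := sep 𝔖.τ fun O => ∃ g m, g ∈ a ∧ App g m O
  have hD : Sub D 𝔖.τ := fun O hO => (mem_sep.1 hO).1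
  have hU := 𝔖.topX.sUn_mem hD
  obtain ⟨O, hO, htO⟩ := hT.prime.union D (sUn D) hD hU (fun x => mem_sUn) <|
    hT.prime.mono (𝔖.img_mem (mem_conds.1 h.mem).1) hU (fun x hx => by
      obtain ⟨y, hy, hyY, hyx⟩ := 𝔖.mem_img.1 hx
      by_contra hxD
      exact hcon ⟨y, x, hy, hyY, hyx, fun g m O hg hO hOτ hxO =>
        hxD (mem_sUn.2 ⟨O, mem_sep.2 ⟨hOτ, g, m, hg, hO⟩, hxO⟩)⟩) h.img
  obtain ⟨hOτ, g, m, hg, hgO⟩ := mem_sep.1 hO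
  exact h.excluded g hg m O hgO ((hT.of_open O hOτ).2 htO)

theorem IsTrueCond.not_badStep (hT : 𝔖.IsTruth t T) {P a A : V} (h : 𝔖.IsTrueCond t T P a)
    (hA : ∀ P' a', 𝔖.IsTrueCond t T P' a' → opair P' a' ∉ A) : ¬ 𝔖.BadStep (opair P a) A := by
  rintro ⟨P₁, a₁, e, hs⟩
  obtain ⟨rfl, rfl⟩ := opair_inj.1 (isOPair_iff.1 e)
  have hP := (mem_conds.1 h.mem).1
  rcases hs with hs | ⟨n, W, hW, hs⟩ | ⟨g, m, C, hg, hC, hCτ, hs⟩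
  · exact hs (h.hasPoint hT)
  · have hWκ := 𝔖.seq_G.mem hW
    have e : 𝔖.img (inter P W) = 𝔖.img P := set_ext fun x => by
      simp only [mem_img, mem_inter]
      exact exists_congr fun y =>
        ⟨fun ⟨h1, h2⟩ => ⟨h1.1, h2⟩, fun ⟨h1, h2⟩ => ⟨⟨h1, (𝔖.inter_G y).1 h2.1 n W hW⟩, h2⟩⟩
    obtain ⟨P', h1, h2, h3⟩ := h.shrink hT hWκ (e.symm ▸ h.img)
    exact hA P' a h1 (hs _ P' a h1.mem (isOPair_iff.2 rfl) h2 (fun _ => id) h3)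
  · have hC𝓑 : C ∈ 𝔖.𝓑 := ((mem_conds.1 h.mem).2.1 g hg).mem hC
    obtain ⟨f, hf⟩ := 𝔖.fun_F.exists_app hC𝓑
    have := h.excluded g hg m C hC
    rw [hT.of_not_open C f hf hCτ] at this
    push Not at this
    obtain ⟨k, E, hE, hTE⟩ := this
    obtain ⟨P', a', h1, h2, h3, h4⟩ :=
      h.exists_forces hT ((mem_seqs.1 (𝔖.fun_F.mem_mem hf).2).mem hE) hTE
    exact hA P' a' h1 (hs _ P' a' h1.mem (isOPair_iff.2 rfl) h2 h3 ⟨f, k, E, hf, hE, h4⟩)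

/-! ### Consistent conditions and their points -/

variable (𝔖) in
/-- A set of conditions that have points and can be extended to meet every requirement. -/
structure IsConsistent (Γ : V) : Prop where
  sub : Sub Γ 𝔖.conds
  hasPoint : ∀ P a, opair P a ∈ Γ → 𝔖.HasPoint P a
  shrink : ∀ P a n W, opair P a ∈ Γ → App 𝔖.G n W →
    ∃ P' a', opair P' a' ∈ Γ ∧ Sub P' P ∧ Sub a a' ∧ IsWellInside 𝔖.K 𝔖.κ P' W
  refute : ∀ P a g m C, opair P a ∈ Γ → g ∈ a → App g m C → C ∉ 𝔖.τ →
    ∃ P' a', opair P' a' ∈ Γ ∧ Sub P' P ∧ Sub a a' ∧ 𝔖.Refutes C P' a'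

/-- Every condition that is true at some point belongs to a consistent set in the model. -/
theorem exists_isConsistent (𝔖 : Presentation V) : ∃ Γ, 𝔖.IsConsistent Γ ∧
    ∀ t T, 𝔖.IsTruth t T → ∀ P a, 𝔖.IsTrueCond t T P a → opair P a ∈ Γ := by
  obtain ⟨I, L, hI, hclosed, hwf, hstep⟩ := exists_inductive_set 𝔖.conds 𝔖.BadStep
  refine ⟨sep 𝔖.conds fun s => s ∉ I, ⟨fun s hs => (mem_sep.1 hs).1, fun P a hs => ?_,
    fun P a n W hs hW => ?_, fun P a g m C hs hg hC hCτ => ?_⟩, fun t T hT P a h => ?_⟩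
  · rw [mem_sep] at hs
    by_contra hcon
    exact hs.2 (hclosed _ hs.1 ⟨P, a, isOPair_iff.2 rfl, .inl hcon⟩)
  · rw [mem_sep] at hs
    by_contra! hcon
    refine hs.2 (hclosed _ hs.1 ⟨P, a, isOPair_iff.2 rfl, .inr (.inl ⟨n, W, hW, ?_⟩)⟩)
    intro s' P' a' hs' e h1 h2 h3
    by_contra hs'I
    rw [isOPair_iff] at e
    exact hcon P' a' (e ▸ mem_sep.2 ⟨hs', hs'I⟩) h1 h2 h3
  · rw [mem_sep] at hs
    by_contra! hcon
    refine hs.2 (hclosed _ hs.1 ⟨P, a, isOPair_iff.2 rfl, .inr (.inr ⟨g, m, C, hg, hC, hCτ, ?_⟩)⟩)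
    intro s' P' a' hs' e h1 h2 h3
    by_contra hs'I
    rw [isOPair_iff] at e
    exact hcon P' a' (e ▸ mem_sep.2 ⟨hs', hs'I⟩) h1 h2 h3
  · refine mem_sep.2 ⟨h.mem, ?_⟩
    suffices ∀ s, s ∈ I → ∀ P a, 𝔖.IsTrueCond t T P a → s ≠ opair P a from
      fun hs => this _ hs P a h rfl
    intro s
    induction s using hwf.induction with | _ s ih => ?_
    rintro hs P a h rfl
    obtain ⟨A, hA, hst⟩ := hstep _ hs
    exact h.not_badStep hT (fun P' a' h' hm => ih _ (hA _ hm).2 (hA _ hm).1 P' a' h' rfl) hst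

theorem IsConsistent.exists_refutes {Γ : V} (hΓ : 𝔖.IsConsistent Γ) {P a n : V}
    (hn : n ∈ omega V) (h : opair P a ∈ Γ) :
    ∃ P' a', opair P' a' ∈ Γ ∧ Sub P' P ∧ Sub a a' ∧ ∀ g m C, g ∈ a → m ∈ n → App g m C →
      C ∉ 𝔖.τ → 𝔖.Refutes C P' a' := by
  have hm := mem_conds.1 (hΓ.sub _ h)
  obtain ⟨k, rfl⟩ := mem_omega.1 hn
  have hfin : (⋃ g ∈ {g | g ∈ a}, ⋃ m ∈ nat V '' Set.Iio k, {C | App g m C}).Finite := by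
    refine hm.2.2.finite.biUnion fun g hg => ((Set.finite_Iio k).image _).biUnion fun m _ =>
      Set.Subsingleton.finite fun C hC C' hC' => ?_
    exact (isSeq_iff.1 (hm.2.1 g hg)).unique hC hC'
  suffices ∀ Q : Set V, Q.Finite → (∀ C ∈ Q, ∃ g m, g ∈ a ∧ App g m C) →
      ∃ P' a', opair P' a' ∈ Γ ∧ Sub P' P ∧ Sub a a' ∧ ∀ C ∈ Q, C ∉ 𝔖.τ → 𝔖.Refutes C P' a' by
    obtain ⟨P', a', h1, h2, h3, h4⟩ := this _ hfin fun C hC => by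
      simp only [Set.mem_iUnion] at hC
      obtain ⟨g, hg, m, -, hC⟩ := hC
      exact ⟨g, m, hg, hC⟩
    refine ⟨P', a', h1, h2, h3, fun g m C hg hm hC => h4 C ?_⟩
    obtain ⟨i, hi, rfl⟩ := mem_nat.1 hm
    simp only [Set.mem_iUnion]
    exact ⟨g, hg, _, ⟨i, hi, rfl⟩, hC⟩
  intro Q hQ hQa
  induction Q, hQ using Set.Finite.induction_on with
  | empty => exact ⟨P, a, h, fun _ => id, fun _ => id, fun C hC => hC.elim⟩
  | @insert C Q _ _ ih =>
    obtain ⟨P₁, a₁, h1, h2, h3, h4⟩ := ih fun C hC => hQa C (.inr hC)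
    by_cases hCτ : C ∈ 𝔖.τ
    · refine ⟨P₁, a₁, h1, h2, h3, fun C' hC' => ?_⟩
      rcases hC' with rfl | hC'
      exacts [fun hn => (hn hCτ).elim, h4 C' hC']
    · obtain ⟨g, m, hg, hC⟩ := hQa C (.inl rfl)
      obtain ⟨P₂, a₂, h5, h6, h7, h8⟩ := hΓ.refute P₁ a₁ g m C h1 (h3 g hg) hC hCτ
      refine ⟨P₂, a₂, h5, fun x hx => h2 x (h6 x hx), fun x hx => h7 x (h3 x hx),
        fun C' hC' hC'τ => ?_⟩
      rcases hC' with rfl | hC'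
      exacts [h8, (h4 C' hC' hC'τ).mono h6 h7]

/-- A decreasing sequence of conditions that meets all requirements. -/
theorem IsConsistent.exists_sequence {Γ P₀ a₀ : V} (hΓ : 𝔖.IsConsistent Γ)
    (h₀ : opair P₀ a₀ ∈ Γ) : ∃ P a : ℕ → V, P 0 = P₀ ∧ a 0 = a₀ ∧
      (∀ k, opair (P k) (a k) ∈ Γ) ∧ (∀ k, Sub (P (k + 1)) (P k)) ∧ (∀ k, Sub (a k) (a (k + 1))) ∧
      (∀ k W, App 𝔖.G (nat V k) W → IsWellInside 𝔖.K 𝔖.κ (P (k + 1)) W) ∧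
      (∀ k i g C, i < k → g ∈ a k → App g (nat V i) C → C ∉ 𝔖.τ →
        𝔖.Refutes C (P (k + 1)) (a (k + 1))) ∧
      ∃ H : V, ∀ s, s ∈ H ↔ ∃ k, s = opair (P k) (a k) := by
  have hΓ' : ∀ s, s ∈ Γ → ∃ P a, s = opair P a := fun s hs => by
    obtain ⟨P, a, -, -, e⟩ := mem_prod.1 (hΓ.sub s hs)
    exact ⟨P, a, e⟩
  obtain ⟨s, hs0, hs, hR, hH⟩ := exists_dependent_sequence Γ (opair P₀ a₀)
    (fun n s s' => ∃ P a P' a', IsOPair s P a ∧ IsOPair s' P' a' ∧ Sub P' P ∧ Sub a a' ∧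
      (∀ W, App 𝔖.G n W → IsWellInside 𝔖.K 𝔖.κ P' W) ∧
      ∀ g m C, g ∈ a → m ∈ n → App g m C → C ∉ 𝔖.τ → 𝔖.Refutes C P' a') h₀ fun k s hs => by
    obtain ⟨P, a, rfl⟩ := hΓ' s hs
    obtain ⟨W, hW⟩ := (isSeq_iff.1 𝔖.seq_G).exists_app (nat_mem_omega k)
    obtain ⟨P₁, a₁, h1, h2, h3, h4⟩ := hΓ.exists_refutes (nat_mem_omega k) hs
    obtain ⟨P₂, a₂, h5, h6, h7, h8⟩ := hΓ.shrink P₁ a₁ _ W h1 hW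
    refine ⟨_, h5, P, a, P₂, a₂, isOPair_iff.2 rfl, isOPair_iff.2 rfl, fun x hx => h2 x (h6 x hx),
      fun x hx => h7 x (h3 x hx), fun W' hW' => ?_, fun g m C hg hm hC hCτ =>
        (h4 g m C hg hm hC hCτ).mono h6 h7⟩
    rwa [(isSeq_iff.1 𝔖.seq_G).unique hW' hW]
  choose P a e using fun k => hΓ' (s k) (hs k)
  have hR' : ∀ k, Sub (P (k + 1)) (P k) ∧ Sub (a k) (a (k + 1)) ∧
      (∀ W, App 𝔖.G (nat V k) W → IsWellInside 𝔖.K 𝔖.κ (P (k + 1)) W) ∧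
      ∀ g m C, g ∈ a k → m ∈ nat V k → App g m C → C ∉ 𝔖.τ →
        𝔖.Refutes C (P (k + 1)) (a (k + 1)) := fun k => by
    obtain ⟨P', a', P'', a'', e1, e2, h⟩ := hR k
    rw [isOPair_iff, e, opair_inj] at e1 e2
    obtain ⟨rfl, rfl⟩ := e1
    obtain ⟨rfl, rfl⟩ := e2
    exact h
  have e0 := opair_inj.1 ((e 0).symm.trans hs0)
  simp only [e] at hs hH
  exact ⟨P, a, e0.1, e0.2, hs, fun k => (hR' k).1, fun k => (hR' k).2.1, fun k => (hR' k).2.2.1,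
    fun k i g C hi hg hC hCτ => (hR' k).2.2.2 g _ C hg (mem_nat.2 ⟨i, hi, rfl⟩) hC hCτ, hH⟩

/-- A consistent condition has a point that satisfies it. -/
theorem IsConsistent.exists_point {Γ P₀ a₀ : V} (hΓ : 𝔖.IsConsistent Γ)
    (h₀ : opair P₀ a₀ ∈ Γ) : ∃ x, x ∈ 𝔖.X ∧ (∀ E, E ∈ 𝔖.𝓑 → 𝔖.Forces E P₀ a₀ → x ∈ E) ∧
      ∀ g m C, g ∈ a₀ → App g m C → x ∉ C := by
  obtain ⟨P, a, rfl, rfl, hmem, hP, ha, hG, href, H, hH⟩ := hΓ.exists_sequence h₀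
  have hPle : ∀ i j, i ≤ j → Sub (P j) (P i) := fun i j hij => by
    induction j, hij using Nat.le_induction with
    | base => exact fun _ => id
    | succ j _ ih => exact fun x hx => ih x (hP j x hx)
  have hale : ∀ i j, i ≤ j → Sub (a i) (a j) := fun i j hij => by
    induction j, hij using Nat.le_induction with
    | base => exact fun _ => id
    | succ j _ ih => exact fun x hx => ha j x (ih x hx)
  have hc := fun k => mem_conds.1 (hΓ.sub _ (hmem k))
  let D := sep 𝔖.κ fun U => ∃ s P a, s ∈ H ∧ IsOPair s P a ∧ (Disj P U ∨
    ∃ g m O, g ∈ a ∧ App g m O ∧ O ∈ 𝔖.τ ∧ ∀ y x, y ∈ U → y ∈ 𝔖.Y → App 𝔖.φ y x → x ∈ O)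
  have hDsub : Sub D 𝔖.κ := fun U hU => (mem_sep.1 hU).1
  have hD : ∀ U, U ∈ D ↔ U ∈ 𝔖.κ ∧ ∃ k, Disj (P k) U ∨ ∃ g m O, g ∈ a k ∧ App g m O ∧ O ∈ 𝔖.τ ∧
      ∀ y x, y ∈ U → y ∈ 𝔖.Y → App 𝔖.φ y x → x ∈ O := fun U => by
    rw [mem_sep]
    refine and_congr_right fun _ => ⟨?_, fun ⟨k, h⟩ => ⟨_, _, _, (hH _).2 ⟨k, rfl⟩,
      isOPair_iff.2 rfl, h⟩⟩
    rintro ⟨s, P', a', hs, e, h⟩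
    obtain ⟨k, rfl⟩ := (hH s).1 hs
    obtain ⟨rfl, rfl⟩ := opair_inj.1 (isOPair_iff.1 e)
    exact ⟨k, h⟩
  obtain ⟨y, hyK, hyD⟩ : ∃ y, y ∈ 𝔖.K ∧ ∀ U, U ∈ D → y ∉ U := by
    by_contra! hcon
    obtain ⟨Q, hQ, hQD, hQK⟩ := 𝔖.compact.exists_finite 𝔖.topK hDsub hcon
    choose! k hk using fun U hU => ((hD U).1 (hQD U hU)).2
    obtain ⟨N, hN⟩ := (hQ.image k).bddAbove
    obtain ⟨y, x, hyP, hyY, hyx, hx⟩ := hΓ.hasPoint _ _ (hmem N)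
    obtain ⟨U, hU, hyU⟩ := hQK y (𝔖.Y_sub y hyY)
    have hkN : k U ≤ N := hN ⟨U, hU, rfl⟩
    rcases hk U hU with h | ⟨g, m, O, hg, hgO, hO, h⟩
    · exact h y (hPle _ _ hkN y hyP) hyU
    · exact hx g m O (hale _ _ hkN g hg) hgO hO (h y x hyU hyY hyx)
  have hin : ∀ k W, IsWellInside 𝔖.K 𝔖.κ (P k) W → y ∈ W := fun k W ⟨U, hU, hd, hcov⟩ =>
    (hcov y hyK).resolve_left (hyD U ((hD U).2 ⟨hU, k, .inl hd⟩))
  have hyY : y ∈ 𝔖.Y := (𝔖.inter_G y).2 fun n W hW => by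
    obtain ⟨k, rfl⟩ := mem_omega.1 ((isSeq_iff.1 𝔖.seq_G).mem_mem hW).1
    exact hin _ W (hG k W hW)
  obtain ⟨x, hyx⟩ := 𝔖.fun_φ.exists_app hyY
  have hxX := (𝔖.fun_φ.mem_mem hyx).2
  have main : ∀ B, B ∈ 𝔖.𝓑 → (∀ k g m, g ∈ a k → App g m B → x ∉ B) ∧
      ∀ k, 𝔖.Forces B (P k) (a k) → x ∈ B := by
    intro B
    induction B using 𝔖.wf.induction with | _ B ih => ?_
    intro hB
    refine ⟨fun k g m hg hgB hxB => ?_, fun k hk => ?_⟩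
    · by_cases hBτ : B ∈ 𝔖.τ
      · obtain ⟨U, hU, hUB⟩ := 𝔖.preimage B hBτ
        refine hyD U ((hD U).2 ⟨hU, k, .inr ⟨g, m, B, hg, hgB, hBτ, fun y x hy hyY hyx => ?_⟩⟩)
          ((hUB y hyY).2 ⟨x, hxB, hyx⟩)
        obtain ⟨x', hx', hyx'⟩ := (hUB y hyY).1 hy
        rwa [𝔖.fun_φ.unique hyx hyx']
      · obtain ⟨i, rfl⟩ := mem_omega.1 ((isSeq_iff.1 ((hc k).2.1 g hg)).mem_mem hgB).1
        obtain ⟨f, n, E, hf, hE, hfor⟩ := href (max k (i + 1)) i g B (by omega)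
          (hale _ _ (le_max_left _ _) g hg) hgB hBτ
        have hav := 𝔖.avoiding B f hf hBτ
        have hE𝓑 := (mem_seqs.1 (𝔖.fun_F.mem_mem hf).2).mem hE
        exact ((hav.1 x).1 hxB).2 n E hE ((ih E (hav.2 n E hE) hE𝓑).2 _ hfor)
    · rcases hk with ⟨-, U, -, hUB, hPU⟩ | ⟨hBτ, f, hf, hfa⟩
      · exact hUB y x (hin k U hPU) hyY hyx
      · have hav := 𝔖.avoiding B f hf hBτ
        refine (hav.1 x).2 ⟨hxX, fun n C hC => ?_⟩
        exact (ih C (hav.2 n C hC) (((hc k).2.1 f hfa).mem hC)).1 k f n hfa hC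
  exact ⟨x, hxX, fun E hE h => (main E hE).2 0 h,
    fun g m C hg hC => (main C (((hc 0).2.1 g hg).mem hC)).1 0 g m hg hC⟩

/-- Finitely many true Borel sets and finitely many sequences of false ones are realized by a point
of the model. -/
theorem IsTruth.exists_point (hT : 𝔖.IsTruth t T) (Es gs : List V)
    (hEs : ∀ E ∈ Es, E ∈ 𝔖.𝓑 ∧ T E)
    (hgs : ∀ g ∈ gs, IsSeq g 𝔖.𝓑 ∧ ∀ m C, App g m C → ¬ T C) :
    ∃ x, x ∈ 𝔖.X ∧ (∀ E ∈ Es, x ∈ E) ∧ ∀ g ∈ gs, ∀ m C, App g m C → x ∉ C := by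
  obtain ⟨P, a, h, hE, hg⟩ : ∃ P a, 𝔖.IsTrueCond t T P a ∧ (∀ E ∈ Es, 𝔖.Forces E P a) ∧
      ∀ g ∈ gs, g ∈ a := by
    induction Es with
    | nil =>
      induction gs with
      | nil =>
        refine ⟨𝔖.K, emp V, ⟨mem_conds.2 ⟨𝔖.topK.2.1, fun g hg => (notMem_emp g hg).elim,
          isFin_emp⟩, ?_, fun g hg => (notMem_emp g hg).elim⟩, by simp, by simp⟩
        rw [img_K]
        exact hT.prime.whole
      | cons g gs ih =>
        obtain ⟨P, a, h, -, hg⟩ := ih fun g hg => hgs g (.tail _ hg)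
        obtain ⟨h1, h2⟩ := hgs g (.head _)
        refine ⟨P, adj a g, h.insert h1 h2, by simp, fun g' hg' => mem_adj.2 ?_⟩
        rcases List.mem_cons.1 hg' with rfl | hg'
        exacts [.inr rfl, .inl (hg g' hg')]
    | cons E Es ih =>
      obtain ⟨P, a, h, hE, hg⟩ := ih fun E hE => hEs E (.tail _ hE)
      obtain ⟨h1, h2⟩ := hEs E (.head _)
      obtain ⟨P', a', h', hP, ha, hf⟩ := h.exists_forces hT h1 h2
      refine ⟨P', a', h', fun E' hE' => ?_, fun g hg' => ha g (hg g hg')⟩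
      rcases List.mem_cons.1 hE' with rfl | hE'
      exacts [hf, (hE E' hE').mono hP ha]
  obtain ⟨Γ, hΓ, hΓt⟩ := 𝔖.exists_isConsistent
  obtain ⟨x, hx, h1, h2⟩ := hΓ.exists_point (hΓt t T hT P a h)
  exact ⟨x, hx, fun E hE' => h1 E (hEs E hE').1 (hE E hE'), fun g hg' m C => h2 g m C (hg g hg')⟩

end Presentation

end Consistency

end SetModel

namespace SetModel

section Truth

variable {V : Type*} [Membership V V] [hV : WFModel V] {𝔖 : Presentation V} {t T : V → Prop}

namespace Presentation.IsTruth

theorem diff (hT : 𝔖.IsTruth t T) {B C : V} (hB : B ∈ 𝔖.𝓑) (hC : C ∈ 𝔖.𝓑)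
    (h : IsDiff C 𝔖.X B) : T C ↔ ¬ T B := by
  constructor
  · intro h1 h2
    obtain ⟨x, -, hx, -⟩ := hT.exists_point [B, C] [] (by simp [*]) (by simp)
    exact ((h x).1 (hx C (by simp))).2 (hx B (by simp))
  · intro h2
    by_contra h1
    obtain ⟨f, hf, hfB⟩ := exists_const_seq hB
    obtain ⟨g, hg, hgC⟩ := exists_const_seq hC
    obtain ⟨x, hxX, -, hx⟩ := hT.exists_point [] [f, g] (by simp)
      (by simp [hf, hg, hfB, hgC, h1, h2])
    exact hx g (by simp) _ C ((hgC _ _).2 ⟨nat_mem_omega 0, rfl⟩)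
      ((h x).2 ⟨hxX, hx f (by simp) _ B ((hfB _ _).2 ⟨nat_mem_omega 0, rfl⟩)⟩)

theorem seqUnion (hT : 𝔖.IsTruth t T) {B f : V} (hB : B ∈ 𝔖.𝓑) (hf : IsSeq f 𝔖.𝓑)
    (h : IsSeqUnion B f) : T B ↔ ∃ n C, App f n C ∧ T C := by
  constructor
  · intro h1
    by_contra! h2
    obtain ⟨x, -, hxB, hx⟩ := hT.exists_point [B] [f] (by simp [*]) (by simpa [hf] using h2)
    obtain ⟨n, C, hC, hxC⟩ := (h x).1 (hxB B (by simp))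
    exact hx f (by simp) n C hC hxC
  · rintro ⟨n, C, hC, hTC⟩
    by_contra h1
    obtain ⟨g, hg, hgB⟩ := exists_const_seq hB
    obtain ⟨x, -, hxC, hx⟩ := hT.exists_point [C] [g] (by simp [hf.mem hC, hTC])
      (by simp [hg, hgB, h1])
    exact hx g (by simp) _ B ((hgB _ _).2 ⟨nat_mem_omega 0, rfl⟩)
      ((h x).2 ⟨n, C, hC, hxC C (by simp)⟩)

theorem seqInter (hT : 𝔖.IsTruth t T) {B f : V} (hB : B ∈ 𝔖.𝓑) (hf : IsSeq f 𝔖.𝓑)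
    (h : IsSeqInter B f) : T B ↔ ∀ n C, App f n C → T C := by
  constructor
  · intro h1 n C hC
    by_contra h2
    obtain ⟨g, hg, hgC⟩ := exists_const_seq (hf.mem hC)
    obtain ⟨x, -, hxB, hx⟩ := hT.exists_point [B] [g] (by simp [*]) (by simp [hg, hgC, h2])
    exact hx g (by simp) _ C ((hgC _ _).2 ⟨nat_mem_omega 0, rfl⟩)
      ((h x).1 (hxB B (by simp)) n C hC)
  · intro h2
    by_contra h1
    obtain ⟨f', hf', hf'C⟩ := exists_function (omega V) 𝔖.𝓑
      (fun n D => ∃ C, App f n C ∧ IsDiff D 𝔖.X C) fun n hn => by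
        obtain ⟨C, hC⟩ := (isSeq_iff.1 hf).exists_app hn
        obtain ⟨D, hD, hD𝓑⟩ := 𝔖.sigma.2.2.1 C (hf.mem hC)
        refine ⟨D, ⟨hD𝓑, C, hC, hD⟩, ?_⟩
        rintro D' ⟨-, C', hC', hD'⟩
        obtain rfl := (isSeq_iff.1 hf).unique hC hC'
        exact set_ext fun x => (hD' x).trans (hD x).symm
    obtain ⟨g, hg, hgB⟩ := exists_const_seq hB
    obtain ⟨x, hxX, -, hx⟩ := hT.exists_point [] [f', g] (by simp) (by
      simp only [List.forall_mem_cons, List.not_mem_nil, false_imp_iff, implies_true, and_true]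
      refine ⟨⟨isSeq_iff.2 hf', fun n D hD => ?_⟩, hg, fun n C hC => ?_⟩
      · obtain ⟨-, hD𝓑, C, hC, hDC⟩ := (hf'C n D).1 hD
        rw [hT.diff (hf.mem hC) hD𝓑 hDC, not_not]
        exact h2 n C hC
      · rwa [((hgB n C).1 hC).2])
    refine hx g (by simp) _ B ((hgB _ _).2 ⟨nat_mem_omega 0, rfl⟩) ((h x).2 fun n C hC => ?_)
    by_contra hxC
    obtain ⟨D, hD, hD𝓑⟩ := 𝔖.sigma.2.2.1 C (hf.mem hC)
    exact hx f' (by simp) n D ((hf'C n D).2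
      ⟨((isSeq_iff.1 hf).mem_mem hC).1, hD𝓑, C, hC, hD⟩) ((hD x).2 ⟨hxX, hxC⟩)

end Presentation.IsTruth

/-- The set of points at which a Borel set of the model is true is Borel. -/
theorem Presentation.measurableSet_truth {Z : Type*} [TopologicalSpace Z] {t T : Z → V → Prop}
    (hT : ∀ z, 𝔖.IsTruth (t z) (T z)) (ht : ∀ O, O ∈ 𝔖.τ → IsOpen {z | t z O}) (B : V)
    (hB : B ∈ 𝔖.𝓑) : @MeasurableSet Z (borel Z) {z | T z B} := by
  let := borel Z
  have : BorelSpace Z := ⟨rfl⟩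
  induction B using 𝔖.wf.induction with | _ B ih => ?_
  by_cases hBτ : B ∈ 𝔖.τ
  · simp only [(hT _).of_open B hBτ]
    exact (ht B hBτ).measurableSet
  · obtain ⟨f, hf⟩ := 𝔖.fun_F.exists_app hB
    have hseq := mem_seqs.1 (𝔖.fun_F.mem_mem hf).2
    choose C hC using fun k => (isSeq_iff.1 hseq).exists_app (nat_mem_omega k)
    have : {z | T z B} = ⋂ k, {z | T z (C k)}ᶜ := by
      ext z
      simp only [Set.mem_iInter, Set.mem_compl_iff]
      refine ((hT z).of_not_open B f hf hBτ).trans ⟨fun h k => h _ _ (hC k), fun h n D hD => ?_⟩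
      obtain ⟨k, rfl⟩ := mem_omega.1 ((isSeq_iff.1 hseq).mem_mem hD).1
      rw [(isSeq_iff.1 hseq).unique hD (hC k)]
      exact h k
    rw [this]
    exact .iInter fun k => (ih _ ((𝔖.avoiding B f hf hBτ).2 _ _ (hC k)) (hseq.mem (hC k))).compl

end Truth

section TransitiveModel

variable {M : Set ZFSet.{u}}

theorem IsTransitiveModel.wfModel (hM : IsTransitiveModel M) : WFModel M :=
  ⟨hM.zfc, InvImage.wf (fun x : M => (x : ZFSet.{u})) ZFSet.mem_wf⟩

/-- A point of a preinterpretation gives a prime filter of open sets. -/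
theorem IsPreinterpretation.isPrimeFilter {X τ : M} {Z : Type u} [TopologicalSpace Z]
    {p : El X → Z} {q : El τ → Set Z} (h : IsPreinterpretation X τ p q) (hX : X ∈ τ) (z : Z) :
    IsPrimeFilter X τ fun O => ∃ hO : O ∈ τ, z ∈ q ⟨O, hO⟩ where
  whole := ⟨hX, by simp [h.whole ⟨X, hX⟩ rfl]⟩
  inter O P Q hO hP hQ hQOP := by
    simp only [hO, hP, hQ, exists_true_left, h.inter ⟨O, hO⟩ ⟨P, hP⟩ ⟨Q, hQ⟩ hQOP, Set.mem_inter_iff]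
  union D O hD hO hOD := by
    rintro ⟨_, hz⟩
    rw [h.union D hD ⟨O, hO⟩ hOD, Set.mem_iUnion] at hz
    obtain ⟨P, hP⟩ := hz
    exact ⟨P.1, P.2, hD _ P.2, hP⟩

end TransitiveModel

end SetModel

theorem mainTheorem4 (M : Set ZFSet.{u}) (hM : SetModel.IsTransitiveModel M)
    (X τ 𝓑 : M) (hX : SetModel.IsInterpretable X τ) (h𝓑 : SetModel.IsBorelAlg X τ 𝓑)
    (Z : Type u) [TopologicalSpace Z] (p : SetModel.El X → Z) (q : SetModel.El τ → Set Z)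
    (hpq : SetModel.IsInterpretation X τ p q) :
    ∃! r : SetModel.El 𝓑 → {S : Set Z // @MeasurableSet Z (borel Z) S},
      (∀ (O : M) (hτ : O ∈ τ) (hO : O ∈ 𝓑), (r ⟨O, hO⟩ : Set Z) = q ⟨O, hτ⟩) ∧
      (∀ B C : SetModel.El 𝓑, SetModel.IsDiff C.1 X B.1 → (r C : Set Z) = (r B : Set Z)ᶜ) ∧
      (∀ f : M, SetModel.IsSeq f 𝓑 → ∀ B : SetModel.El 𝓑, SetModel.IsSeqUnion B.1 f →
        (r B : Set Z) = ⋃ (C : SetModel.El 𝓑) (_ : ∃ n : M, SetModel.App f n C.1), (r C : Set Z)) ∧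
      (∀ f : M, SetModel.IsSeq f 𝓑 → ∀ B : SetModel.El 𝓑, SetModel.IsSeqInter B.1 f →
        (r B : Set Z) = ⋂ (C : SetModel.El 𝓑) (_ : ∃ n : M, SetModel.App f n C.1), (r C : Set Z)) := by
  have := hM.wfModel
  obtain ⟨𝔖, rfl, rfl, rfl⟩ := hX.exists_presentation h𝓑
  have hpre := hpq.isPreinterpretation
  choose T hT using fun z => SetModel.Presentation.exists_isTruth
    (hpre.isPrimeFilter 𝔖.topX.2.1 z)
  have hTO : ∀ O (hO : O ∈ 𝔖.τ), {z | T z O} = q ⟨O, hO⟩ := fun O hO => by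
    ext z
    exact ((hT z).of_open O hO).trans ⟨fun ⟨_, h⟩ => h, fun h => ⟨hO, h⟩⟩
  have hopen : ∀ O, O ∈ 𝔖.τ → IsOpen {z | ∃ hO : O ∈ 𝔖.τ, z ∈ q ⟨O, hO⟩} := fun O hO => by
    simpa [hO] using hpre.isOpen ⟨O, hO⟩
  refine ⟨fun B => ⟨{z | T z B.1}, 𝔖.measurableSet_truth hT hopen B.1 B.2⟩,
    ⟨fun O hO _ => hTO O hO, fun B C h => ?_, fun f hf B h => ?_, fun f hf B h => ?_⟩, ?_⟩
  · ext z
    exact (hT z).diff B.2 C.2 h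
  · ext z
    simp only [Set.mem_iUnion]
    refine ((hT z).seqUnion B.2 hf h).trans ⟨fun ⟨n, C, hC, h⟩ => ⟨⟨C, hf.mem hC⟩, ⟨n, hC⟩, h⟩,
      fun ⟨C, ⟨n, hC⟩, h⟩ => ⟨n, C, hC, h⟩⟩
  · ext z
    simp only [Set.mem_iInter]
    refine ((hT z).seqInter B.2 hf h).trans ⟨fun h C ⟨n, hC⟩ => h n C hC,
      fun h n C hC => h ⟨C, hf.mem hC⟩ ⟨n, hC⟩⟩
  · rintro r ⟨h1, h2, h3, -⟩
    suffices ∀ B (hB : B ∈ 𝔖.𝓑), (r ⟨B, hB⟩ : Set Z) = {z | T z B} from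
      funext fun B => Subtype.ext (this B.1 B.2)
    intro B
    induction B using 𝔖.wf.induction with | _ B ih => ?_
    intro hB
    by_cases hBτ : B ∈ 𝔖.τ
    · rw [h1 B hBτ hB, hTO B hBτ]
    · obtain ⟨f, hf⟩ := 𝔖.fun_F.exists_app hB
      have hseq := SetModel.mem_seqs.1 (𝔖.fun_F.mem_mem hf).2
      obtain ⟨hav, hlt⟩ := 𝔖.avoiding B f hf hBτ
      obtain ⟨U, hU, hU𝓑⟩ := 𝔖.sigma.2.2.2 f hseq
      have hBU : SetModel.IsDiff B 𝔖.X U := fun x => by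
        rw [hav x, hU x]
        push Not
        rfl
      rw [h2 ⟨U, hU𝓑⟩ ⟨B, hB⟩ hBU, h3 f hseq ⟨U, hU𝓑⟩ hU]
      ext z
      simp only [Set.mem_compl_iff, Set.mem_iUnion, not_exists]
      refine Iff.trans ⟨fun h n C hC hTC => ?_, fun h C ⟨n, hC⟩ hz => ?_⟩
        ((hT z).of_not_open B f hf hBτ).symm
      · refine h ⟨C, hseq.mem hC⟩ ⟨n, hC⟩ ?_
        rw [ih C (hlt n C hC)]
        exact hTC
      · rw [ih C.1 (hlt n C.1 hC)] at hz
        exact h n C.1 hC hz
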